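/- **Setting.** There are $n$ players. Player $i$ has a finite state set $S_i$, a finite action set $A_i$ and transition probabilities $P_i(s_i'\mid s_i,a_i)$; the players' states move independently given the joint state and action, starting from a given joint state $s^0$. Player $i$ has a reward $r_i(s,a)\in[0,1]$ depending on the joint state $s$ and joint action $a$. For some $\tau>0$, every chain $P^{\pi_i}(s_i'\mid s_i)=\sum_{a_i}P_i(s_i'\mid s_i,a_i)\pi_i(a_i\mid s_i)$ induced by a stationary policy $\pi_i$ satisfies $\|(v-v')P^{\pi_i}\|_1\le e^{-1/\tau}\|v-v'\|_1$ for all $v,v'\in\Delta(S_i)$. Let $$\mathcal P_i=\Big\{\rho_i\in\mathbb R_+^{S_i\times A_i}:\ \sum_{s_i,a_i}\big(P_i(s_i'\mid s_i,a_i)-\mathbb I_{\{s_i=s_i'\}}\big)\rho_i(s_i,a_i)=0\ \ \forall s_i',\quad \sum_{s_i,a_i}\rho_i(s_i,a_i)=1\Big\},$$ $\mathcal P_i^{\delta_i}=\{\rho_i\in\mathcal P_i:\rho_i\ge\delta_i\}$ with $\delta_i>0$, $\mathcal P^\delta=\prod_i\mathcal P_i^{\delta_i}$, and $$V_i(\rho)=\sum_{s,a}\prod_j\rho_j(s_j,a_j)\,r_i(s,a),\qquad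 \Psi(\theta,\rho)=\sum_i\big[V_i(\theta_i,\rho_{-i})-V_i(\rho)\big],\qquad D_{KL}(x,y)=\sum_z x_z\log\frac{x_z}{y_z}.$$ **Algorithm.** Inputs: step sizes $\eta^\ell\ge0$ ($\ell\ge1$), an integer threshold $d\ge1$, and $\rho_i^1\in\mathcal P_i^{\delta_i}$ for each $i$. Put $\tau^1=0$. Batch $k=1,2,\dots$ begins at time $\tau^k$; let $\tau_i^k\ge\tau^k+d$ be the first time such that all states of $S_i$ are visited during $[\tau^k+d,\tau_i^k]$, and let the batch end at $\tau^{k+1}=\max_i\tau_i^k$. At the times $\tau^k<t\le\tau^{k+1}$ (and also at $t=0$ if $k=1$) the players draw their actions independently from $\pi_i^k(a_i\mid s_i)=\rho_i^k(s_i,a_i)/\sum_{a_i'}\rho_i^k(s_i,a_i')$. The vector $R_i^k\in\mathbb R^{S_i\times A_i}$ starts at $0$; for each $t\in[\tau^k+d,\tau^{k+1}]$ at which the state $s_i^t$ is visited by player $i$ for the first time in that interval, the normalized reward term $\frac{r_i(s^t,a^t)-1}{\pi_i^k(a_i^t\mid s_i^t)}$ is added to the coordinate $(s_i^t,a_i^t)$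 (so rewards are normalized to $[-1,0]$). At the end of batch $k$, $$\rho_i^{k+\frac12}=\operatorname*{argmax}_{\rho_i\in\Delta(S_i\times A_i)}\big\{\langle\eta^kR_i^k,\rho_i\rangle-D_{KL}(\rho_i,\rho_i^k)\big\},\qquad \rho_i^{k+1}=\operatorname*{argmin}_{\rho_i\in\mathcal P_i}D_{KL}(\rho_i,\rho_i^{k+\frac12}).$$ **Theorem.** Let $\varepsilon>0$ and assume $d\ge\tau\log\big(\frac{2n}{\varepsilon}\sum_{i=1}^n|A_i||S_i|\big)$, $\sum_{\ell=1}^\infty\eta^\ell=\infty$, $\sum_{\ell=1}^\infty(\eta^\ell)^2<\infty$, and that the initial points satisfy $D_{KL}(\theta_i,\rho_i^1)\le2\log(|S_i||A_i|)$ for all $i$ and all $\theta_i\in\mathcal P_i^{\delta_i}$ (for instance, $\rho_i^1$ is the element of $\mathcal P_i^{\delta_i}$ of maximal entropy, or $\rho_i^1\ge(|S_i||A_i|)^{-2}$ coordinatewise). Then, with $w^k=\sum_{\ell=1}^k\eta^\ell$, $$\max_{\theta\in\mathcal P^\delta}\ \mathbb E\Big[\sum_{\ell=1}^k\frac{\eta^\ell}{w^k}\Psi(\theta,\rho^\ell)\Big]\le\varepsilon$$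 for every $k$ such that $$\sum_{\ell=1}^k\eta^\ell\ \ge\ \frac1\varepsilon\Big(4\sum_{i=1}^n\log(|S_i||A_i|)+\Big(\sum_{i=1}^n|A_i|\Big)\sum_{\ell=1}^k(\eta^\ell)^2\Big).$$ -/

import Mathlib

open MeasureTheory Filter

/-- An `n`-player stochastic game with independent chains: player `i` has finite state set `S i` and
finite action set `A i`, its own transition probabilities `P i s a s'` (the probability of moving
from `s` to `s'` under action `a`), and a reward `r i s a` in `[0, 1]` that depends on the joint
state `s` and the joint action `a`. -/
structure StochasticGame {n : ℕ} (S A : Fin n → Type*)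
    [∀ i, Fintype (S i)] [∀ i, Fintype (A i)] where
  P : ∀ i, S i → A i → S i → ℝ
  P_mem : ∀ i s a, P i s a ∈ stdSimplex ℝ (S i)
  r : Fin n → (∀ j, S j) → (∀ j, A j) → ℝ
  r_mem : ∀ i s a, r i s a ∈ Set.Icc (0 : ℝ) 1

/-- A vector over the state-action pairs of every player (a profile of occupation measures). -/
abbrev OccProfile {n : ℕ} (S A : Fin n → Type*) : Type _ := ∀ i, S i × A i → ℝ

/-- A realized trajectory of joint states and joint actions. -/
abbrev GamePath {n : ℕ} (S A : Fin n → Type*) : Type _ := ℕ → (∀ i, S i) × (∀ i, A i)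

/-- Kullback-Leibler divergence `∑ z, x z log (x z / y z)`; here the second argument is always a
strictly positive vector, and `0 log 0 = 0`. -/
noncomputable def klDivergence {α : Type*} [Fintype α] (x y : α → ℝ) : ℝ :=
  ∑ z, x z * Real.log (x z / y z)

/-- The stationary policy `π(a|s) = ρ(s,a) / ∑ a', ρ(s,a')` of an occupation measure. -/
noncomputable def occPolicy {σ α : Type*} [Fintype α] (ρ : σ × α → ℝ) (s : σ) (a : α) : ℝ :=
  ρ (s, a) / ∑ a', ρ (s, a')

/-- `IsTwoStepKL Q y x x'`: the point `x'` is the result of the two-step mirror descent update of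
`x` with score `y`, namely an entropic step on the simplex followed by a KL projection onto `Q`. -/
def IsTwoStepKL {α : Type*} [Fintype α] (Q : Set (α → ℝ)) (y x x' : α → ℝ) : Prop :=
  ∃ h ∈ stdSimplex ℝ α,
    IsMaxOn (fun z : α → ℝ => ∑ c, y c * z c - klDivergence z x) (stdSimplex ℝ α) h ∧
    x' ∈ Q ∧ IsMinOn (fun z : α → ℝ => klDivergence z h) Q x'

namespace StochasticGame

variable {n : ℕ} {S A : Fin n → Type*} [∀ i, Fintype (S i)] [∀ i, Fintype (A i)]

/-- The Markov chain induced on `S i` by a stationary policy `π` of player `i`. -/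
def inducedChain (G : StochasticGame S A) (i : Fin n) (π : S i → A i → ℝ) (s s' : S i) : ℝ :=
  ∑ a, G.P i s a s' * π s a

/-- The mixing time of every chain induced by a stationary policy is at most `τ`:
`‖(v - v') P^π‖₁ ≤ exp (-1/τ) ‖v - v'‖₁` for all distributions `v`, `v'` on `S i`. -/
def MixingTimeLE (G : StochasticGame S A) (τ : ℝ) : Prop :=
  ∀ (i : Fin n) (π : S i → A i → ℝ), (∀ s, π s ∈ stdSimplex ℝ (A i)) →
    ∀ v ∈ stdSimplex ℝ (S i), ∀ v' ∈ stdSimplex ℝ (S i),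
      ∑ s', |∑ s, (v s - v' s) * G.inducedChain i π s s'|
        ≤ Real.exp (-1 / τ) * ∑ s, |v s - v' s|

open Classical in
/-- The polytope of feasible occupation measures of player `i`. -/
def occPolytope (G : StochasticGame S A) (i : Fin n) : Set (S i × A i → ℝ) :=
  {ρ | (∀ z, 0 ≤ ρ z) ∧
    (∀ s', ∑ z : S i × A i, (G.P i z.1 z.2 s' - if z.1 = s' then 1 else 0) * ρ z = 0) ∧
    ∑ z, ρ z = 1}

/-- The shrunk polytope: feasible occupation measures with all coordinates at least `δ`. -/
def shrunkPolytope (G : StochasticGame S A) (i : Fin n) (δ : ℝ) : Set (S i × A i → ℝ) :=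
  {ρ | ρ ∈ G.occPolytope i ∧ ∀ z, δ ≤ ρ z}

/-- The payoff `V_i(ρ) = ∑_{s,a} (∏_j ρ_j(s_j,a_j)) r_i(s,a)` of the virtual game. -/
def payoff (G : StochasticGame S A) (i : Fin n) (ρ : OccProfile S A) : ℝ :=
  ∑ s : (∀ j, S j), ∑ a : (∀ j, A j), (∏ j, ρ j (s j, a j)) * G.r i s a

/-- The Nikaido-Isoda function `Ψ(θ,ρ) = ∑_i [V_i(θ_i,ρ_{-i}) - V_i(ρ)]`. -/
def nikaidoIsoda (G : StochasticGame S A) (θ ρ : OccProfile S A) : ℝ :=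
  ∑ i, (G.payoff i (Function.update ρ i (θ i)) - G.payoff i ρ)

/-- For a batch that starts at time `b`: the first time `m ≥ b + d` such that every state of player
`i` is visited during `[b + d, m]` (`⊤` if there is no such time). -/
noncomputable def coverTime (d : ℕ) (x : GamePath S A) (b : ℕ∞) (i : Fin n) : ℕ∞ :=
  sInf {t : ℕ∞ | ∃ m : ℕ, t = m ∧ b + d ≤ m ∧
    ∀ σ : S i, ∃ u : ℕ, b + d ≤ u ∧ u ≤ m ∧ (x u).1 i = σ}

/-- The times `τ^k`. Batches are numbered from `1`; batch `k` begins at `τ^k` (with `τ^1 = 0`) and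
ends at `τ^{k+1}`, the largest of the players' cover times. (The index `0` is not used.) -/
noncomputable def batchTime (d : ℕ) (x : GamePath S A) : ℕ → ℕ∞
  | 0 => 0
  | 1 => 0
  | k + 2 => ⨆ i, coverTime d x (batchTime d x (k + 1)) i

/-- The batch whose policy is in force at time `t`: the least `k ≥ 1` with `t ≤ τ^{k+1}`.
So the actions at the times `τ^k < t ≤ τ^{k+1}` (and at time `0` if `k = 1`) follow `π^k`. -/
noncomputable def batchIndex (d : ℕ) (x : GamePath S A) (t : ℕ) : ℕ :=
  sInf {k : ℕ | 1 ≤ k ∧ (t : ℕ∞) ≤ batchTime d x (k + 1)}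

open Classical in
/-- The estimator `R_i^k` that player `i` forms in batch `k` while it plays `π`: for each time `t`
of the sampling interval `[τ^k + d, τ^{k+1}]` at which the current state of player `i` is visited
for the first time in that interval, add `(r_i(s^t,a^t) - 1) / π(a_i^t|s_i^t)` to the coordinate
`(s_i^t, a_i^t)`. The rewards enter in the normalization `r_i - 1 ∈ [-1, 0]`. -/
noncomputable def estimator (G : StochasticGame S A) (d : ℕ) (x : GamePath S A) (k : ℕ) (i : Fin n)
    (π : S i → A i → ℝ) (z : S i × A i) : ℝ :=
  ∑ t ∈ Finset.Icc ((batchTime d x k).toNat + d) (batchTime d x (k + 1)).toNat,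
    if (∀ u, (batchTime d x k).toNat + d ≤ u → u < t → (x u).1 i ≠ (x t).1 i) ∧
        z = ((x t).1 i, (x t).2 i)
    then (G.r i (x t).1 (x t).2 - 1) / π ((x t).1 i) ((x t).2 i) else 0

/-- The occupation measures `ρ k x` (`k ≥ 1`) produced on the trajectory `x` by the algorithm with
initial profile `ρ₁`, step sizes `η` and threshold `d`, when the players use the two-step KL mirror
descent update onto their occupation polytopes. -/
def IsKLMirrorDescent (G : StochasticGame S A) (d : ℕ) (η : ℕ → ℝ) (ρ₁ : OccProfile S A)
    (ρ : ℕ → GamePath S A → OccProfile S A) : Prop :=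
  (∀ x, ρ 1 x = ρ₁) ∧
  ∀ k, 1 ≤ k → ∀ x i,
    IsTwoStepKL (G.occPolytope i)
      (fun z => η k * G.estimator d x k i (occPolicy (ρ k x i)) z) (ρ k x i) (ρ (k + 1) x i)

open Classical in
/-- The law of the play: `X t` is the joint state and action at time `t`, the initial state is `s₀`,
at time `t` the players draw their actions independently from the policies `π^k` of the batch `k` in
force, and the states then move independently according to the `P i`. It is given through the
probabilities of all finite trajectories. -/
def IsPlay (G : StochasticGame S A) (d : ℕ) (ρ : ℕ → GamePath S A → OccProfile S A)
    (s₀ : ∀ i, S i) {Ω : Type*} [MeasurableSpace Ω] (μ : Measure Ω)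
    (X : ℕ → Ω → (∀ i, S i) × (∀ i, A i)) : Prop :=
  (∀ t z, MeasurableSet {ω | X t ω = z}) ∧
  ∀ (T : ℕ) (x : GamePath S A),
    μ {ω | ∀ t ≤ T, X t ω = x t} = ENNReal.ofReal
      ((if (x 0).1 = s₀ then 1 else 0) *
        (∏ t ∈ Finset.range (T + 1), ∏ i,
          occPolicy (ρ (batchIndex d x t) x i) ((x t).1 i) ((x t).2 i)) *
        ∏ t ∈ Finset.range T, ∏ i, G.P i ((x t).1 i) ((x t).2 i) ((x (t + 1)).1 i))

end StochasticGame

/-!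
The convergence bound combines a pathwise regret bound for KL mirror descent with a conditional
analysis of the estimators, batch by batch.

*Regret.* The entropic step has the Gibbs point `x exp y / Z` as its unique maximizer
(`eq_gibbs_of_isMaxOn`), and the KL projection onto the occupation polytope is positive and satisfies
the Pythagorean inequality (`pos_of_isMinOn_klDivergence`, `klDivergence_pythagoras`). Since the
scores are nonpositive, `exp y ≤ 1 + y + y ^ 2 / 2` gives a regret of at most the initial divergence
plus half of the sum of the squared local norms of the scores
(`IsKLMirrorDescent.sum_linearRegret_le`). These lemmas also show that the update is unique, hence
that the iterates are functions of the history with finitely many values.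

*Law of a batch.* Fix a history up to the time at which a batch begins. As long as player `i` has not
visited its state `s` in the sampling phase, the batch goes on, so all players keep their policies.
Therefore their state-action pairs stay independent on that event: player `i` follows its chain
killed at `s`, all others follow their chains (`IsPlay.measureReal_avoidSet`). A contracting chain
visits every state of positive stationary mass (`tendsto_sum_killedLaw`), so batches end almost
surely, and the law of the first sample is a sum over the time of the first visit
(`IsPlay.hasSum_firstSample`).

*Bias and second moment.* At a first visit of player `i` the other players are distributed as
independent copies of their chains after at least `d - 1` steps. Their laws are within
`|A j| |S j| exp (-d / τ)` of stationarity: the factor `exp (-1 / τ)` that is missing from the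
contraction comes from a comparison of the transitions out of arbitrary state-action pairs
(`MixingTimeLE.sum_abs_transition_sub_le`). So the estimator is nearly unbiased for the payoff
gradient, up to the constant `-1` of the normalized rewards, and its squared local norm is at most
`∑ |A i|` in expectation (`IsPlay.abs_setIntegral_estimator_sub_le`,
`IsPlay.integral_localNormSq_le`). As `Ψ(θ, ·)` is the sum of the players' linear regrets
(`nikaidoIsoda_eq`), the bias contributes at most `ε / 2`, and the regret, divided by the sum of the
step sizes, at most the other `ε / 2`.
-/

/-! ### KL divergence and two-step mirror descent -/

section KL

variable {α : Type*} [Fintype α]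

theorem sub_le_mul_log_div {x y : ℝ} (hx : 0 ≤ x) (hy : 0 < y) : x - y ≤ x * Real.log (x / y) := by
  rcases hx.eq_or_lt with rfl | hx
  · simp [hy.le]
  · have h := Real.one_sub_inv_le_log_of_pos (div_pos hx hy)
    have h2 := mul_le_mul_of_nonneg_left h hx.le
    have : x * (1 - (x / y)⁻¹) = x - y := by field_simp
    linarith

theorem sub_lt_mul_log_div {x y : ℝ} (hx : 0 ≤ x) (hy : 0 < y) (hxy : x ≠ y) :
    x - y < x * Real.log (x / y) := by
  rcases hx.eq_or_lt with rfl | hx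
  · simp [hy]
  · have h := Real.log_lt_sub_one_of_pos (div_pos hy hx) (by
      rw [Ne, div_eq_one_iff_eq hx.ne']; exact fun h => hxy h.symm)
    have h2 := mul_lt_mul_of_pos_left h hx
    have e1 : x * (y / x - 1) = y - x := by field_simp
    have e2 : Real.log (x / y) = - Real.log (y / x) := by rw [← Real.log_inv, inv_div]
    rw [e2]; linarith

theorem klDivergence_nonneg {x y : α → ℝ} (hx : x ∈ stdSimplex ℝ α) (hy : ∀ z, 0 < y z)
    (hy1 : ∑ z, y z = 1) : 0 ≤ klDivergence x y := by
  have : ∑ z, (x z - y z) ≤ klDivergence x y :=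
    Finset.sum_le_sum fun z _ => sub_le_mul_log_div (hx.1 z) (hy z)
  rw [Finset.sum_sub_distrib, hx.2, hy1] at this
  linarith

theorem eq_of_klDivergence_nonpos {x y : α → ℝ} (hx : x ∈ stdSimplex ℝ α) (hy : ∀ z, 0 < y z)
    (hy1 : ∑ z, y z = 1) (h : klDivergence x y ≤ 0) : x = y := by
  by_contra hne
  obtain ⟨z, hz⟩ := Function.ne_iff.1 hne
  have : ∑ z, (x z - y z) < klDivergence x y :=
    Finset.sum_lt_sum (fun z _ => sub_le_mul_log_div (hx.1 z) (hy z))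
      ⟨z, Finset.mem_univ _, sub_lt_mul_log_div (hx.1 z) (hy z) hz⟩
  rw [Finset.sum_sub_distrib, hx.2, hy1] at this
  linarith

theorem klDivergence_self {x : α → ℝ} (hx : ∀ z, 0 < x z) : klDivergence x x = 0 := by
  simp [klDivergence, div_self (hx _).ne']

/-- Change of the reference point in the KL divergence. -/
theorem klDivergence_sub_klDivergence {x y h : α → ℝ} (hy : ∀ z, 0 < y z) (hh : ∀ z, 0 < h z) :
    klDivergence x h - klDivergence x y = ∑ z, x z * Real.log (y z / h z) := by
  simp only [klDivergence, ← Finset.sum_sub_distrib]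
  refine Finset.sum_congr rfl fun z _ => ?_
  by_cases hx : x z = 0
  · simp [hx]
  · rw [Real.log_div hx (hh z).ne', Real.log_div hx (hy z).ne',
      Real.log_div (hy z).ne' (hh z).ne']
    ring

/-- The exponential reweighting of `x` with score `y`, normalized to total mass one. -/
noncomputable def gibbs (x y : α → ℝ) (z : α) : ℝ :=
  x z * Real.exp (y z) / ∑ c, x c * Real.exp (y c)

variable {x y : α → ℝ}

theorem partition_pos (hx : ∀ z, 0 < x z) (hx1 : ∑ z, x z = 1) :
    0 < ∑ c, x c * Real.exp (y c) := by
  have : Nonempty α := by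
    by_contra h
    rw [not_nonempty_iff] at h
    simp at hx1
  exact Finset.sum_pos (fun c _ => mul_pos (hx c) (Real.exp_pos _)) Finset.univ_nonempty

theorem gibbs_pos (hx : ∀ z, 0 < x z) (hx1 : ∑ z, x z = 1) (z : α) : 0 < gibbs x y z :=
  div_pos (mul_pos (hx z) (Real.exp_pos _)) (partition_pos hx hx1)

theorem gibbs_mem (hx : ∀ z, 0 < x z) (hx1 : ∑ z, x z = 1) : gibbs x y ∈ stdSimplex ℝ α :=
  ⟨fun z => (gibbs_pos hx hx1 z).le, by
    simp only [gibbs]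
    rw [← Finset.sum_div, div_self (partition_pos hx hx1).ne']⟩

/-- The variational identity behind the entropic step: the objective at `θ` is the log-partition
function minus the divergence of `θ` from the Gibbs point. -/
theorem klDivergence_gibbs (hx : ∀ z, 0 < x z) (hx1 : ∑ z, x z = 1) {θ : α → ℝ}
    (hθ : ∑ z, θ z = 1) :
    klDivergence θ (gibbs x y) =
      klDivergence θ x - ∑ z, y z * θ z + Real.log (∑ c, x c * Real.exp (y c)) := by
  have hZ := partition_pos (y := y) hx hx1
  have h := klDivergence_sub_klDivergence (x := θ) hx (gibbs_pos (y := y) hx hx1)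
  have e : ∀ z, θ z * Real.log (x z / gibbs x y z) =
      θ z * Real.log (∑ c, x c * Real.exp (y c)) - y z * θ z := by
    intro z
    have : x z / gibbs x y z = (∑ c, x c * Real.exp (y c)) / Real.exp (y z) := by
      rw [gibbs, div_div_eq_mul_div, mul_div_mul_left _ _ (hx z).ne']
    rw [this, Real.log_div hZ.ne' (Real.exp_pos _).ne', Real.log_exp]
    ring
  simp only [e, Finset.sum_sub_distrib, ← Finset.sum_mul, hθ] at h
  linarith

theorem eq_gibbs_of_isMaxOn (hx : ∀ z, 0 < x z) (hx1 : ∑ z, x z = 1) {h : α → ℝ}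
    (hh : h ∈ stdSimplex ℝ α)
    (hmax : IsMaxOn (fun z : α → ℝ => ∑ c, y c * z c - klDivergence z x) (stdSimplex ℝ α) h) :
    h = gibbs x y := by
  have h1 := hmax (gibbs_mem (y := y) hx hx1)
  simp only [Set.mem_ofPred_eq] at h1
  have h2 := klDivergence_gibbs (y := y) hx hx1 hh.2
  have h3 := klDivergence_gibbs (y := y) hx hx1 (gibbs_mem (y := y) hx hx1).2
  rw [klDivergence_self (gibbs_pos hx hx1)] at h3
  exact eq_of_klDivergence_nonpos hh (gibbs_pos hx hx1) (gibbs_mem hx hx1).2 (by linarith)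

theorem exp_le_of_nonpos {t : ℝ} (ht : t ≤ 0) : Real.exp t ≤ 1 + t + t ^ 2 / 2 := by
  have h := Real.quadratic_le_exp_of_nonneg (neg_nonneg.2 ht)
  have h2 : Real.exp t * Real.exp (-t) = 1 := by rw [← Real.exp_add]; simp
  have h3 : Real.exp t * (1 + -t + (-t) ^ 2 / 2) ≤ 1 := by
    exact (mul_le_mul_of_nonneg_left h (Real.exp_pos t).le).trans_eq h2
  have hp : 0 < 1 + -t + (-t) ^ 2 / 2 := by nlinarith
  -- the product of the two Taylor polynomials is `1 + t ^ 4 / 4`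
  have h4 : 1 ≤ (1 + t + t ^ 2 / 2) * (1 + -t + (-t) ^ 2 / 2) := by nlinarith [sq_nonneg (t ^ 2)]
  exact le_of_mul_le_mul_right (h3.trans h4) hp

theorem log_partition_le (hx : ∀ z, 0 < x z) (hx1 : ∑ z, x z = 1) (hy : ∀ z, y z ≤ 0) :
    Real.log (∑ c, x c * Real.exp (y c)) ≤ ∑ z, y z * x z + 1 / 2 * ∑ z, x z * y z ^ 2 := by
  have h1 := Real.log_le_sub_one_of_pos (partition_pos (y := y) hx hx1)
  have h2 : ∑ c, x c * Real.exp (y c) ≤ ∑ c, x c * (1 + y c + y c ^ 2 / 2) :=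
    Finset.sum_le_sum fun c _ => mul_le_mul_of_nonneg_left (exp_le_of_nonpos (hy c)) (hx c).le
  have h3 : ∑ c, x c * (1 + y c + y c ^ 2 / 2) =
      1 + ∑ z, y z * x z + 1 / 2 * ∑ z, x z * y z ^ 2 := by
    have : ∀ c, x c * (1 + y c + y c ^ 2 / 2) = x c + y c * x c + 1 / 2 * (x c * y c ^ 2) :=
      fun c => by ring
    simp only [this, Finset.sum_add_distrib, ← Finset.mul_sum, hx1]
  linarith

/-- The scalar function `u ↦ u log (u / h)` is convex; along a segment that leaves `0` there is
the additional term `t * b * log t`. -/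
theorem mul_log_div_segment_le {a b h t : ℝ} (ha : 0 ≤ a) (hb : 0 < b) (hh : 0 < h)
    (ht : 0 < t) (ht1 : t ≤ 1) :
    ((1 - t) * a + t * b) * Real.log (((1 - t) * a + t * b) / h) ≤
      (1 - t) * (a * Real.log (a / h)) + t * (b * Real.log (b / h)) +
        (if a = 0 then b else 0) * (t * Real.log t) := by
  by_cases h0 : a = 0
  · subst h0
    rw [if_pos rfl]
    have : ((1 - t) * 0 + t * b) / h = t * (b / h) := by ring
    rw [this, Real.log_mul ht.ne' (div_pos hb hh).ne']
    apply le_of_eq; simp; ring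
  · rw [if_neg h0]
    have hc := Real.convexOn_mul_log.2 (x := a / h) (by simp; positivity) (y := b / h)
      (by simp; positivity) (sub_nonneg.2 ht1) ht.le (by ring)
    simp only [smul_eq_mul] at hc
    have e : (1 - t) * (a / h) + t * (b / h) = ((1 - t) * a + t * b) / h := by ring
    rw [e] at hc
    have := mul_le_mul_of_nonneg_left hc hh.le
    have e1 : h * (((1 - t) * a + t * b) / h * Real.log (((1 - t) * a + t * b) / h)) =
      ((1 - t) * a + t * b) * Real.log (((1 - t) * a + t * b) / h) := by field_simp
    have e2 : h * ((1 - t) * (a / h * Real.log (a / h)) + t * (b / h * Real.log (b / h))) =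
      (1 - t) * (a * Real.log (a / h)) + t * (b * Real.log (b / h)) := by field_simp
    rw [e1, e2] at this
    linarith

/-- A KL projection onto a convex set with a positive point is positive: moving from the boundary
towards the positive point decreases the divergence at the rate `t log t`. -/
theorem pos_of_isMinOn_klDivergence {Q : Set (α → ℝ)} (hQ : Convex ℝ Q)
    (hQ0 : ∀ q ∈ Q, ∀ z, 0 ≤ q z) {p : α → ℝ} (hp : p ∈ Q) (hp0 : ∀ z, 0 < p z) {h x' : α → ℝ}
    (hh : ∀ z, 0 < h z) (hx' : x' ∈ Q) (hmin : IsMinOn (fun z : α → ℝ => klDivergence z h) Q x') :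
    ∀ z, 0 < x' z := by
  by_contra! hneg
  obtain ⟨z₀, hz₀⟩ := hneg
  have hz0 : x' z₀ = 0 := le_antisymm hz₀ (hQ0 _ hx' _)
  set c := ∑ z, if x' z = 0 then p z else 0 with hc
  have hcpos : 0 < c := Finset.sum_pos' (fun z _ => by split_ifs; exacts [(hp0 z).le, le_rfl])
    ⟨z₀, Finset.mem_univ _, by rw [if_pos hz0]; exact hp0 z₀⟩
  set D := klDivergence p h - klDivergence x' h
  have key : ∀ t : ℝ, 0 < t → t ≤ 1 → 0 ≤ D + c * Real.log t := by
    intro t ht ht1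
    have hm : (1 - t) • x' + t • p ∈ Q := hQ hx' hp (by linarith) ht.le (by ring)
    have h1 := hmin hm
    simp only [Set.mem_ofPred_eq] at h1
    have h2 : klDivergence ((1 - t) • x' + t • p) h ≤
        (1 - t) * klDivergence x' h + t * klDivergence p h + c * (t * Real.log t) := by
      rw [hc]
      simp only [klDivergence, Finset.mul_sum, Finset.sum_mul]
      rw [← Finset.sum_add_distrib, ← Finset.sum_add_distrib]
      refine Finset.sum_le_sum fun z _ => ?_
      simpa using mul_log_div_segment_le (hQ0 _ hx' z) (hp0 z) (hh z) ht ht1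
    have h3 : 0 ≤ t * (D + c * Real.log t) := by
      have : t * (D + c * Real.log t) = t * klDivergence p h - t * klDivergence x' h
        + c * (t * Real.log t) := by simp only [D]; ring
      rw [this]; linarith
    exact nonneg_of_mul_nonneg_right h3 ht
  -- `t = exp (-(D + 1) / c)` turns the inequality into `0 ≤ -1`
  have hD : 0 ≤ D := by simpa using key 1 one_pos le_rfl
  have := key (Real.exp (-(D + 1) / c)) (Real.exp_pos _) (by
    rw [Real.exp_le_one_iff]
    exact div_nonpos_of_nonpos_of_nonneg (by linarith) hcpos.le)
  rw [Real.log_exp, mul_div_cancel₀ _ hcpos.ne'] at this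
  linarith

/-- The Pythagorean inequality of KL projections. -/
theorem klDivergence_pythagoras {Q : Set (α → ℝ)} (hQ : Convex ℝ Q)
    (hQ1 : ∀ q ∈ Q, ∑ z, q z = 1) {h x' : α → ℝ} (hh : ∀ z, 0 < h z) (hx' : x' ∈ Q)
    (hx'0 : ∀ z, 0 < x' z) (hmin : IsMinOn (fun z : α → ℝ => klDivergence z h) Q x')
    {θ : α → ℝ} (hθ : θ ∈ Q) :
    klDivergence θ x' + klDivergence x' h ≤ klDivergence θ h := by
  have hder : HasDerivAt (fun t : ℝ => klDivergence (fun z => x' z + t * (θ z - x' z)) h)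
      (∑ z, ((θ z - x' z) * Real.log (x' z / h z) + (θ z - x' z))) 0 := by
    unfold klDivergence
    refine HasDerivAt.fun_sum fun z _ => ?_
    have h1 : HasDerivAt (fun t : ℝ => x' z + t * (θ z - x' z)) (θ z - x' z) 0 := by
      simpa using ((hasDerivAt_id (0 : ℝ)).mul_const (θ z - x' z)).const_add (x' z)
    have h2 := (h1.div_const (h z)).log (by simpa using ⟨(hx'0 z).ne', (hh z).ne'⟩)
    refine (h1.fun_mul h2).congr_deriv ?_
    have := (hx'0 z).ne'
    have := (hh z).ne'
    simp only [zero_mul, add_zero]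
    field_simp
  have hloc : 0 ≤ ∑ z, ((θ z - x' z) * Real.log (x' z / h z) + (θ z - x' z)) := by
    have hseq := hder.tendsto_slope_zero_right
    refine ge_of_tendsto hseq ?_
    filter_upwards [Ioo_mem_nhdsGT (zero_lt_one' ℝ)] with t ht
    have hm : (fun z => x' z + t * (θ z - x' z)) ∈ Q := by
      have := hQ hx' hθ (sub_nonneg.2 ht.2.le) ht.1.le (by ring)
      convert this using 1
      ext z; simp; ring
    have h1 := hmin hm
    simp only [Set.mem_ofPred_eq] at h1
    exact mul_nonneg (inv_nonneg.2 ht.1.le) (by simpa using h1)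
  rw [Finset.sum_add_distrib, Finset.sum_sub_distrib, hQ1 _ hθ, hQ1 _ hx', sub_self, add_zero]
    at hloc
  simp only [sub_mul, Finset.sum_sub_distrib] at hloc
  have h1 := klDivergence_sub_klDivergence (x := θ) hx'0 hh
  have h2 : klDivergence x' h = ∑ z, x' z * Real.log (x' z / h z) := rfl
  linarith

section TwoStep

variable {Q : Set (α → ℝ)} (hQ : Convex ℝ Q) (hQs : Q ⊆ stdSimplex ℝ α) {p : α → ℝ}
  (hp : p ∈ Q) (hp0 : ∀ z, 0 < p z) {x' : α → ℝ} (hx : ∀ z, 0 < x z) (hx1 : ∑ z, x z = 1)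
  (hstep : IsTwoStepKL Q y x x')
include hQ hQs hp hp0 hx hx1 hstep

theorem IsTwoStepKL.gibbs_projection :
    x' ∈ Q ∧ (∀ z, 0 < x' z) ∧
      IsMinOn (fun z : α → ℝ => klDivergence z (gibbs x y)) Q x' := by
  obtain ⟨h, hh, hmax, hx'Q, hmin⟩ := hstep
  obtain rfl := eq_gibbs_of_isMaxOn hx hx1 hh hmax
  exact ⟨hx'Q, pos_of_isMinOn_klDivergence hQ (fun q hq => (hQs hq).1) hp hp0
    (gibbs_pos hx hx1) hx'Q hmin, hmin⟩

theorem IsTwoStepKL.unique {x'' : α → ℝ} (hstep' : IsTwoStepKL Q y x x'') : x'' = x' := by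
  obtain ⟨h1, h2, h3⟩ := hstep.gibbs_projection hQ hQs hp hp0 hx hx1
  obtain ⟨h1', h2', h3'⟩ := hstep'.gibbs_projection hQ hQs hp hp0 hx hx1
  have hpy := klDivergence_pythagoras hQ (fun q hq => (hQs hq).2) (gibbs_pos hx hx1) h1 h2 h3 h1'
  have hle := h3' h1
  simp only [Set.mem_ofPred_eq] at hle
  exact eq_of_klDivergence_nonpos (hQs h1') h2 (hQs h1).2 (by linarith)

/-- The regret of one mirror descent step with a nonpositive score. -/
theorem IsTwoStepKL.regret_le (hy : ∀ z, y z ≤ 0) {θ : α → ℝ} (hθ : θ ∈ Q) :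
    ∑ z, y z * (θ z - x z) ≤
      klDivergence θ x - klDivergence θ x' + 1 / 2 * ∑ z, x z * y z ^ 2 := by
  obtain ⟨h1, h2, h3⟩ := hstep.gibbs_projection hQ hQs hp hp0 hx hx1
  have hpy := klDivergence_pythagoras hQ (fun q hq => (hQs hq).2) (gibbs_pos hx hx1) h1 h2 h3 hθ
  have hnn := klDivergence_nonneg (hQs h1) (gibbs_pos (y := y) hx hx1) (gibbs_mem hx hx1).2
  have hg := klDivergence_gibbs (y := y) hx hx1 (hQs hθ).2
  have hl := log_partition_le hx hx1 hy
  simp only [mul_sub, Finset.sum_sub_distrib]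
  linarith

end TwoStep

end KL

/-! ### Product distributions and killed Markov chains -/

section ProductWeights

variable {ι : Type*} [Fintype ι] [DecidableEq ι] {α : ι → Type*} [∀ j, Fintype (α j)]

/-- The sum of `φ` over all profiles, weighted with the product of the weights `p j`: the
expectation of `φ` under a product distribution when every `p j` is a distribution. -/
def prodExp (p : ∀ j, α j → ℝ) (φ : (∀ j, α j) → ℝ) : ℝ := ∑ w, (∏ j, p j (w j)) * φ w

theorem sum_prod_apply (p : ∀ j, α j → ℝ) : ∑ w : ∀ j, α j, ∏ j, p j (w j) = ∏ j, ∑ a, p j a := by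
  rw [Finset.prod_univ_sum, Fintype.piFinset_univ]

omit [∀ j, Fintype (α j)] in
theorem prod_update_apply (p : ∀ j, α j → ℝ) (i : ι) (q : α i → ℝ) (w : ∀ j, α j) :
    ∏ j, Function.update p i q j (w j) = q (w i) * ∏ j ∈ Finset.univ.erase i, p j (w j) := by
  rw [← Finset.mul_prod_erase _ _ (Finset.mem_univ i), Function.update_self]
  congr 1
  refine Finset.prod_congr rfl fun j hj => ?_
  rw [Function.update_of_ne (Finset.ne_of_mem_erase hj)]

theorem prodExp_const {p : ∀ j, α j → ℝ} (hp : ∀ j, ∑ a, p j a = 1) (c : ℝ) :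
    prodExp p (fun _ => c) = c := by
  rw [prodExp, ← Finset.sum_mul, sum_prod_apply, Finset.prod_eq_one fun j _ => hp j, one_mul]

theorem prodExp_add (p : ∀ j, α j → ℝ) (φ ψ : (∀ j, α j) → ℝ) :
    prodExp p (fun w => φ w + ψ w) = prodExp p φ + prodExp p ψ := by
  simp only [prodExp, mul_add, Finset.sum_add_distrib]

/-- Linearity in the weights of one factor. -/
theorem prodExp_update (p : ∀ j, α j → ℝ) (i : ι) (q : α i → ℝ) (φ : (∀ j, α j) → ℝ) :
    prodExp (Function.update p i q) φ =
      ∑ z, q z * prodExp (Function.update p i (Set.indicator {z} 1)) φ := by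
  classical
  simp only [prodExp, prod_update_apply, Finset.mul_sum]
  rw [Finset.sum_comm]
  refine Finset.sum_congr rfl fun w _ => ?_
  rw [Finset.sum_eq_single (w i)]
  · simp; ring
  · intro z _ hz
    rw [Set.indicator_of_notMem (by simpa using hz.symm)]; simp
  · simp

open Classical in
/-- The contribution of the profiles with prescribed coordinate `i`. -/
theorem sum_ite_prod_mul (p : ∀ j, α j → ℝ) (i : ι) (z : α i) (φ : (∀ j, α j) → ℝ) :
    ∑ w, (if w i = z then (∏ j, p j (w j)) * φ w else 0) =
      p i z * prodExp (Function.update p i (Set.indicator {z} 1)) φ := by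
  rw [prodExp, Finset.mul_sum]
  refine Finset.sum_congr rfl fun w _ => ?_
  rw [prod_update_apply]
  by_cases h : w i = z
  · rw [if_pos h, ← Finset.mul_prod_erase _ _ (Finset.mem_univ i), h]
    simp; ring
  · rw [if_neg h, Set.indicator_of_notMem (by simpa using h)]; simp

theorem prodExp_update_indicator_congr (p : ∀ j, α j → ℝ) (i : ι) (z : α i)
    {φ ψ : (∀ j, α j) → ℝ} (h : ∀ w, w i = z → φ w = ψ w) :
    prodExp (Function.update p i (Set.indicator {z} 1)) φ =
      prodExp (Function.update p i (Set.indicator {z} 1)) ψ := by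
  refine Finset.sum_congr rfl fun w _ => ?_
  by_cases hw : w i = z
  · rw [h w hw]
  · rw [prod_update_apply, Set.indicator_of_notMem (by simpa using hw)]; simp

theorem indicator_mem_stdSimplex {β : Type*} [Fintype β] (z : β) :
    (Set.indicator {z} 1 : β → ℝ) ∈ stdSimplex ℝ β := by
  classical
  have : (Set.indicator {z} 1 : β → ℝ) = Pi.single z 1 := by
    ext c; simp [Set.indicator_apply, Pi.single_apply]
  rw [this]
  exact single_mem_stdSimplex ℝ z

theorem prodExp_le {p : ∀ j, α j → ℝ} (hp : ∀ j, p j ∈ stdSimplex ℝ (α j))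
    {φ : (∀ j, α j) → ℝ} {c : ℝ} (hφ : ∀ w, φ w ≤ c) : prodExp p φ ≤ c := by
  rw [← prodExp_const (fun j => (hp j).2) c]
  exact Finset.sum_le_sum fun w _ =>
    mul_le_mul_of_nonneg_left (hφ w) (Finset.prod_nonneg fun j _ => (hp j).1 _)

theorem abs_prodExp_update_sub_le {p : ∀ j, α j → ℝ} (hp : ∀ j, p j ∈ stdSimplex ℝ (α j)) (i : ι)
    (q q' : α i → ℝ) {φ : (∀ j, α j) → ℝ} {c : ℝ} (hφ : ∀ w, |φ w| ≤ c) :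
    |prodExp (Function.update p i q) φ - prodExp (Function.update p i q') φ| ≤
      c * ∑ a, |q a - q' a| := by
  have hmass : ∑ w : ∀ j, α j, |q (w i) - q' (w i)| * ∏ j ∈ Finset.univ.erase i, p j (w j) =
      ∑ a, |q a - q' a| := by
    simp only [← prod_update_apply p i (fun a => |q a - q' a|)]
    rw [sum_prod_apply, ← Finset.mul_prod_erase _ _ (Finset.mem_univ i), Function.update_self,
      Finset.prod_eq_one, mul_one]
    intro j hj
    rw [Function.update_of_ne (Finset.ne_of_mem_erase hj)]
    exact (hp j).2
  rw [← hmass, prodExp, prodExp, ← Finset.sum_sub_distrib, Finset.mul_sum]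
  refine (Finset.abs_sum_le_sum_abs _ _).trans (Finset.sum_le_sum fun w _ => ?_)
  have hnn : 0 ≤ ∏ j ∈ Finset.univ.erase i, p j (w j) := Finset.prod_nonneg fun j _ => (hp j).1 _
  rw [prod_update_apply, prod_update_apply, ← sub_mul, ← sub_mul, abs_mul, abs_mul,
    abs_of_nonneg hnn, mul_comm]
  exact mul_le_mul_of_nonneg_right (hφ w) (mul_nonneg (abs_nonneg _) hnn)

/-- Replacing the factors of a product distribution one after the other. -/
theorem abs_prodExp_sub_le {p q : ∀ j, α j → ℝ} (hp : ∀ j, p j ∈ stdSimplex ℝ (α j))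
    (hq : ∀ j, q j ∈ stdSimplex ℝ (α j)) {φ : (∀ j, α j) → ℝ} {c : ℝ} (hφ : ∀ w, |φ w| ≤ c) :
    |prodExp p φ - prodExp q φ| ≤ c * ∑ j, ∑ a, |p j a - q j a| := by
  have key : ∀ T : Finset ι, |prodExp (T.piecewise p q) φ - prodExp q φ| ≤
      c * ∑ j ∈ T, ∑ a, |p j a - q j a| := by
    intro T
    induction T using Finset.induction_on with
    | empty => simp
    | insert i T hi ih =>
      rw [Finset.sum_insert hi, mul_add, Finset.piecewise_insert]
      have hm : ∀ j, T.piecewise p q j ∈ stdSimplex ℝ (α j) := by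
        intro j
        by_cases h : j ∈ T
        · rw [Finset.piecewise_eq_of_mem _ _ _ h]; exact hp j
        · rw [Finset.piecewise_eq_of_notMem _ _ _ h]; exact hq j
      have h1 := abs_prodExp_update_sub_le hm i (p i) (q i) hφ
      have h2 : Function.update (T.piecewise p q) i (q i) = T.piecewise p q := by
        rw [Function.update_eq_self_iff, Finset.piecewise_eq_of_notMem _ _ _ hi]
      rw [h2] at h1
      exact (abs_sub_le _ _ _).trans (add_le_add h1 ih)
  simpa using key Finset.univ

/-- A function with values in an interval of length one can be centred, which saves a factor two. -/
theorem abs_prodExp_sub_le_half {p q : ∀ j, α j → ℝ} (hp : ∀ j, p j ∈ stdSimplex ℝ (α j))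
    (hq : ∀ j, q j ∈ stdSimplex ℝ (α j)) {φ : (∀ j, α j) → ℝ}
    (hφ : ∀ w, φ w ∈ Set.Icc (-1 : ℝ) 0) :
    |prodExp p φ - prodExp q φ| ≤ 1 / 2 * ∑ j, ∑ a, |p j a - q j a| := by
  have h := abs_prodExp_sub_le hp hq (φ := fun w => φ w + 1 / 2) (c := 1 / 2) (fun w => by
    rw [abs_le]; constructor <;> linarith [(hφ w).1, (hφ w).2])
  rwa [prodExp_add p, prodExp_add q, prodExp_const fun j => (hp j).2,
    prodExp_const fun j => (hq j).2, add_sub_add_right_eq_sub] at h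

end ProductWeights

section KilledChain

variable {σ : Type*} [Fintype σ]

open Classical in
/-- The law, after `m` further steps, of a chain with transition matrix `K` and initial law `q₀`
that is killed right after it visits `B` at a step `≥ d - 1`. For `B = ∅` this is the law of the chain; for
`B = {s}` the mass at `s` after `m ≥ d - 1` steps is the probability that this is the first visit
to `s` since step `d - 1`. -/
noncomputable def killedLaw (K : σ → σ → ℝ) (B : Set σ) (d : ℕ) (q₀ : σ → ℝ) : ℕ → σ → ℝ
  | 0 => q₀
  | m + 1 => fun s' => ∑ s, (if d ≤ m + 1 ∧ s ∈ B then 0 else killedLaw K B d q₀ m s) * K s s'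

variable {K : σ → σ → ℝ} (hK : ∀ s, K s ∈ stdSimplex ℝ σ) {B : Set σ} {d : ℕ} {q₀ : σ → ℝ}
  (hq₀ : q₀ ∈ stdSimplex ℝ σ)

include hK in
theorem sum_step_eq (v : σ → ℝ) : ∑ s', ∑ s, v s * K s s' = ∑ s, v s := by
  rw [Finset.sum_comm]
  refine Finset.sum_congr rfl fun s _ => ?_
  rw [← Finset.mul_sum, (hK s).2, mul_one]

include hK in
theorem step_mem {v : σ → ℝ} (hv : v ∈ stdSimplex ℝ σ) :
    (fun s' => ∑ s, v s * K s s') ∈ stdSimplex ℝ σ :=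
  ⟨fun s' => Finset.sum_nonneg fun s _ => mul_nonneg (hv.1 s) ((hK s).1 s'), by
    rw [sum_step_eq hK, hv.2]⟩

include hK hq₀

theorem killedLaw_nonneg (m : ℕ) (s : σ) : 0 ≤ killedLaw K B d q₀ m s := by
  induction m generalizing s with
  | zero => exact hq₀.1 s
  | succ m ih =>
    refine Finset.sum_nonneg fun s' _ => mul_nonneg ?_ ((hK s').1 s)
    split_ifs
    exacts [le_rfl, ih s']

theorem killedLaw_empty_mem (m : ℕ) : killedLaw K ∅ d q₀ m ∈ stdSimplex ℝ σ := by
  induction m with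
  | zero => exact hq₀
  | succ m ih => simpa [killedLaw] using step_mem hK ih

theorem sum_killedLaw_of_lt {m : ℕ} (hm : m < d) : ∑ s, killedLaw K B d q₀ m s = 1 := by
  induction m with
  | zero => exact hq₀.2
  | succ m ih =>
    have : ¬ d ≤ m + 1 := by omega
    simp only [killedLaw, this, false_and, if_false]
    rw [sum_step_eq hK, ih (by omega)]

omit hq₀ in
theorem sum_killedLaw_succ {m : ℕ} (s : σ) (hm : d ≤ m + 1) :
    ∑ s', killedLaw K {s} d q₀ (m + 1) s' =
      ∑ s', killedLaw K {s} d q₀ m s' - killedLaw K {s} d q₀ m s := by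
  classical
  simp only [killedLaw, hm, true_and, Set.mem_singleton_iff]
  rw [sum_step_eq hK, eq_sub_iff_add_eq, ← Finset.sum_erase_add _ _ (Finset.mem_univ s), if_pos rfl,
    add_zero, ← Finset.sum_erase_add Finset.univ _ (Finset.mem_univ s)]
  congr 1
  exact Finset.sum_congr rfl fun x hx => if_neg (Finset.ne_of_mem_erase hx)

variable {κ : ℝ} (hκ0 : 0 ≤ κ) (hκ1 : κ < 1)
  (hmix : ∀ v ∈ stdSimplex ℝ σ, ∀ v' ∈ stdSimplex ℝ σ,
    ∑ s', |∑ s, (v s - v' s) * K s s'| ≤ κ * ∑ s, |v s - v' s|)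
  {ν : σ → ℝ} (hν : ν ∈ stdSimplex ℝ σ) (hνK : ∀ s', ∑ s, ν s * K s s' = ν s')

omit hK hq₀ in
include hmix hν in
/-- The contraction of distributions extends to nonnegative vectors of equal mass. -/
theorem sum_abs_step_sub_le {v : σ → ℝ} (hv : ∀ s, 0 ≤ v s) {c : ℝ} (hc : ∑ s, v s = c) :
    ∑ s', |∑ s, (v s - c * ν s) * K s s'| ≤ κ * ∑ s, |v s - c * ν s| := by
  have hc0 : 0 ≤ c := hc ▸ Finset.sum_nonneg fun s _ => hv s
  rcases hc0.eq_or_lt with rfl | hc0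
  · have : ∀ s, v s = 0 := fun s =>
      (Finset.sum_eq_zero_iff_of_nonneg fun s _ => hv s).1 hc s (Finset.mem_univ s)
    simp [this]
  · have h := hmix (fun s => v s / c) ⟨fun s => div_nonneg (hv s) hc0.le, by
      rw [← Finset.sum_div, hc, div_self hc0.ne']⟩ ν hν
    have h2 := mul_le_mul_of_nonneg_left h hc0.le
    have e : ∀ s, v s - c * ν s = c * (v s / c - ν s) := fun s => by field_simp
    simp only [e, abs_mul, abs_of_pos hc0, mul_assoc, ← Finset.mul_sum]
    rwa [mul_left_comm]

include hκ0 hmix hν hνK in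
theorem sum_abs_killedLaw_empty_sub_le (m : ℕ) :
    ∑ s, |killedLaw K ∅ d q₀ m s - ν s| ≤ κ ^ m * ∑ s, |q₀ s - ν s| := by
  induction m with
  | zero => simp [killedLaw]
  | succ m ih =>
    have h := hmix _ (killedLaw_empty_mem hK (d := d) hq₀ m) ν hν
    have e : ∀ s', ∑ s, (killedLaw K ∅ d q₀ m s - ν s) * K s s' =
        killedLaw K ∅ d q₀ (m + 1) s' - ν s' := by
      intro s'
      simp [killedLaw, sub_mul, Finset.sum_sub_distrib, hνK]
    simp only [e] at h
    refine h.trans ?_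
    rw [pow_succ', mul_assoc]
    exact mul_le_mul_of_nonneg_left ih hκ0

omit hκ0 in
include hκ1 hmix hν hνK in
/-- A contracting chain visits every state of positive stationary mass. With `G` the surviving mass
and `e` the distance of the surviving law from `G • ν`, the potential
`e / (1 - κ) + (2 / (1 - κ) + 1) G` drops by at least `ν s * G` at every step. -/
theorem tendsto_sum_killedLaw (hd : 1 ≤ d) {s : σ} (hs : 0 < ν s) :
    Tendsto (fun m => ∑ s', killedLaw K {s} d q₀ m s') atTop (nhds 0) := by
  set q := killedLaw K {s} d q₀ with hq
  set M : ℕ → ℝ := fun m => ∑ s', q m s' with hM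
  set e : ℕ → ℝ := fun m => ∑ s', |q m s' - M m * ν s'| with he
  have hq0 : ∀ m s', 0 ≤ q m s' := fun m s' => killedLaw_nonneg hK hq₀ m s'
  have hM0 : ∀ m, 0 ≤ M m := fun m => Finset.sum_nonneg fun s' _ => hq0 m s'
  have he0 : ∀ m, 0 ≤ e m := fun m => Finset.sum_nonneg fun s' _ => abs_nonneg _
  have hMs : ∀ m, d ≤ m + 1 → M (m + 1) = M m - q m s := fun m hm =>
    sum_killedLaw_succ hK s hm
  have hes : ∀ m, d ≤ m + 1 → e (m + 1) ≤ κ * e m + 2 * q m s := by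
    intro m hm
    have h1 := sum_abs_step_sub_le (K := K) hmix hν (hq0 m) (c := M m) rfl
    have h2 : ∀ s', q (m + 1) s' - M (m + 1) * ν s' =
        (∑ x, (q m x - M m * ν x) * K x s') + q m s * (ν s' - K s s') := by
      intro s'
      have h3 : q (m + 1) s' = ∑ x, q m x * K x s' - q m s * K s s' := by
        classical
        rw [hq]
        simp only [killedLaw, hm, true_and, Set.mem_singleton_iff]
        rw [eq_sub_iff_add_eq, ← Finset.sum_erase_add _ _ (Finset.mem_univ s), if_pos rfl,
          zero_mul, add_zero, ← Finset.sum_erase_add Finset.univ _ (Finset.mem_univ s)]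
        congr 1
        exact Finset.sum_congr rfl fun x hx => by rw [if_neg (Finset.ne_of_mem_erase hx)]
      rw [h3, hMs m hm]
      simp only [sub_mul, Finset.sum_sub_distrib, mul_assoc, ← Finset.mul_sum, hνK]
      ring
    calc e (m + 1) ≤ ∑ s', (|∑ x, (q m x - M m * ν x) * K x s'| + q m s * (ν s' + K s s')) := by
          refine Finset.sum_le_sum fun s' _ => ?_
          rw [h2]
          refine (abs_add_le _ _).trans (add_le_add le_rfl ?_)
          rw [abs_mul, abs_of_nonneg (hq0 m s)]
          refine mul_le_mul_of_nonneg_left ?_ (hq0 m s)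
          rw [abs_le]; constructor <;> linarith [hν.1 s', (hK s).1 s']
      _ ≤ κ * e m + 2 * q m s := by
          rw [Finset.sum_add_distrib, ← Finset.mul_sum, Finset.sum_add_distrib, hν.2, (hK s).2]
          linarith
  set Φ : ℕ → ℝ := fun m => e m / (1 - κ) + (2 / (1 - κ) + 1) * M m with hΦ
  have hκ' : 0 < 1 - κ := by linarith
  have hΦ0 : ∀ m, 0 ≤ Φ m := fun m =>
    add_nonneg (div_nonneg (he0 m) hκ'.le) (mul_nonneg (by positivity) (hM0 m))
  have hΦs : ∀ m, d ≤ m + 1 → Φ (m + 1) ≤ Φ m - ν s * M m := by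
    intro m hm
    have h1 : ν s * M m ≤ e m + q m s := by
      have : |q m s - M m * ν s| ≤ e m :=
        Finset.single_le_sum (f := fun s' => |q m s' - M m * ν s'|)
          (fun s' _ => abs_nonneg _) (Finset.mem_univ s)
      linarith [(abs_le.1 this).1]
    have h2 : e (m + 1) / (1 - κ) ≤ (κ * e m + 2 * q m s) / (1 - κ) :=
      div_le_div_of_nonneg_right (hes m hm) hκ'.le
    have h3 : (κ * e m + 2 * q m s) / (1 - κ) = e m / (1 - κ) - e m + 2 / (1 - κ) * q m s := by
      field_simp; ring
    simp only [hΦ]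
    rw [hMs m hm]
    linarith
  have hanti : ∀ m, d ≤ m + 1 → M (m + 1) ≤ M m := fun m hm => by
    rw [hMs m hm]; linarith [hq0 m s]
  have hbound : ∀ m, Φ (d - 1 + m) + m * (ν s * M (d - 1 + m)) ≤ Φ (d - 1) := by
    intro m
    induction m with
    | zero => simp
    | succ m ih =>
      have h1 := hΦs (d - 1 + m) (by omega)
      have h2 := mul_le_mul_of_nonneg_left (hanti (d - 1 + m) (by omega)) hs.le
      have h3 := mul_le_mul_of_nonneg_left h2 (Nat.cast_nonneg (α := ℝ) (m + 1))
      rw [← add_assoc]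
      push_cast at h3 ⊢
      linarith
  have hshift : Tendsto (fun m => M (m + (d - 1))) atTop (nhds 0) := by
    have hlim : Tendsto (fun m : ℕ => Φ (d - 1) / ν s / (m : ℝ)) atTop (nhds 0) :=
      tendsto_const_div_atTop_nhds_zero_nat _
    refine tendsto_of_tendsto_of_tendsto_of_le_of_le' tendsto_const_nhds hlim
      (Eventually.of_forall fun m => hM0 _) ?_
    filter_upwards [eventually_gt_atTop 0] with m hm
    have hm' : (0 : ℝ) < m := Nat.cast_pos.2 hm
    rw [le_div_iff₀ hm', le_div_iff₀ hs, add_comm m]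
    have := hbound m
    linarith [hΦ0 (d - 1 + m)]
  exact (tendsto_add_atTop_iff_nat (d - 1)).1 hshift

include hκ1 hmix hν hνK in
/-- The times of the first visit since step `d - 1` form a probability distribution. -/
theorem hasSum_killedLaw (hd : 1 ≤ d) {s : σ} (hs : 0 < ν s) :
    HasSum (fun m => killedLaw K {s} d q₀ (d - 1 + m) s) 1 := by
  rw [hasSum_iff_tendsto_nat_of_nonneg fun m => killedLaw_nonneg hK hq₀ _ _]
  have hpart : ∀ N, ∑ m ∈ Finset.range N, killedLaw K {s} d q₀ (d - 1 + m) s =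
      1 - ∑ s', killedLaw K {s} d q₀ (N + (d - 1)) s' := by
    intro N
    induction N with
    | zero => simp [sum_killedLaw_of_lt hK hq₀ (B := {s}) (m := d - 1) (d := d) (by omega)]
    | succ N ih =>
      rw [Finset.sum_range_succ, ih, show N + 1 + (d - 1) = N + (d - 1) + 1 by ring,
        sum_killedLaw_succ hK s (by omega), add_comm N]
      ring
  simp only [hpart]
  have h := (tendsto_add_atTop_iff_nat (d - 1)).2
    (tendsto_sum_killedLaw hK hq₀ hκ1 hmix hν hνK hd hs)
  simpa using h.const_sub 1

end KilledChain

/-! ### Occupation measures and the virtual game -/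

section OccupationMeasure

variable {σ α : Type*} [Fintype α] {v : σ × α → ℝ} (hv : ∀ z, 0 < v z)

/-- The state marginal of an occupation measure. -/
noncomputable def occMarginal (v : σ × α → ℝ) (s : σ) : ℝ := ∑ a, v (s, a)

variable [Nonempty α]
include hv

theorem occMarginal_pos (s : σ) : 0 < occMarginal v s :=
  Finset.sum_pos (fun _ _ => hv _) Finset.univ_nonempty

theorem occPolicy_pos (s : σ) (a : α) : 0 < occPolicy v s a :=
  div_pos (hv _) (occMarginal_pos hv s)

theorem occPolicy_mem (s : σ) : occPolicy v s ∈ stdSimplex ℝ α :=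
  ⟨fun a => (occPolicy_pos hv s a).le, by
    simp only [occPolicy]
    rw [← Finset.sum_div]
    exact div_self (occMarginal_pos hv s).ne'⟩

theorem occMarginal_mul_occPolicy (s : σ) (a : α) :
    occMarginal v s * occPolicy v s a = v (s, a) :=
  mul_div_cancel₀ _ (occMarginal_pos hv s).ne'

end OccupationMeasure

/-- The law of a state-action pair whose state has law `q` and whose action follows `π`. -/
def pairLaw {σ α : Type*} (q : σ → ℝ) (π : σ → α → ℝ) (z : σ × α) : ℝ := q z.1 * π z.1 z.2

theorem sum_pairLaw {σ α : Type*} [Fintype σ] [Fintype α] {π : σ → α → ℝ}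
    (hπ : ∀ s, π s ∈ stdSimplex ℝ α) (q : σ → ℝ) : ∑ z, pairLaw q π z = ∑ s, q s := by
  rw [Fintype.sum_prod_type]
  simp only [pairLaw, ← Finset.mul_sum, (hπ _).2, mul_one]

theorem pairLaw_mem {σ α : Type*} [Fintype σ] [Fintype α] {π : σ → α → ℝ}
    (hπ : ∀ s, π s ∈ stdSimplex ℝ α) {q : σ → ℝ} (hq : q ∈ stdSimplex ℝ σ) :
    pairLaw q π ∈ stdSimplex ℝ (σ × α) :=
  ⟨fun z => mul_nonneg (hq.1 _) ((hπ _).1 _), by rw [sum_pairLaw hπ, hq.2]⟩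

theorem sum_abs_pairLaw_sub {σ α : Type*} [Fintype σ] [Fintype α] {π : σ → α → ℝ}
    (hπ : ∀ s, π s ∈ stdSimplex ℝ α) (q q' : σ → ℝ) :
    ∑ z, |pairLaw q π z - pairLaw q' π z| = ∑ s, |q s - q' s| := by
  rw [← sum_pairLaw hπ]
  refine Finset.sum_congr rfl fun z _ => ?_
  rw [pairLaw, pairLaw, pairLaw, ← sub_mul, abs_mul, abs_of_nonneg ((hπ _).1 _)]

namespace StochasticGame

variable {n : ℕ} {S A : Fin n → Type*} [∀ i, Fintype (S i)] [∀ i, Fintype (A i)]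
  (G : StochasticGame S A)

theorem convex_occPolytope (i : Fin n) : Convex ℝ (G.occPolytope i) := by
  rintro x ⟨hx0, hxs, hx1⟩ y ⟨hy0, hys, hy1⟩ a b ha hb hab
  refine ⟨fun z => add_nonneg (mul_nonneg ha (hx0 z)) (mul_nonneg hb (hy0 z)), fun s' => ?_, ?_⟩
  · have := congrArg₂ (fun p q => a * p + b * q) (hxs s') (hys s')
    simp only [Finset.mul_sum, mul_zero, add_zero, ← Finset.sum_add_distrib] at this
    refine Eq.trans (Finset.sum_congr rfl fun z _ => ?_) this
    simp only [Pi.add_apply, Pi.smul_apply, smul_eq_mul]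
    ring
  · simp only [Pi.add_apply, Pi.smul_apply, smul_eq_mul, Finset.sum_add_distrib, ← Finset.mul_sum,
      hx1, hy1, mul_one, hab]

theorem occPolytope_subset (i : Fin n) : G.occPolytope i ⊆ stdSimplex ℝ (S i × A i) :=
  fun _ h => ⟨h.1, h.2.2⟩

variable {G} {i : Fin n}

theorem inducedChain_mem {π : S i → A i → ℝ} (hπ : ∀ s, π s ∈ stdSimplex ℝ (A i)) (s : S i) :
    G.inducedChain i π s ∈ stdSimplex ℝ (S i) :=
  ⟨fun s' => Finset.sum_nonneg fun a _ => mul_nonneg ((G.P_mem i s a).1 s') ((hπ s).1 a), by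
    simp only [inducedChain]
    rw [Finset.sum_comm]
    simp only [← Finset.sum_mul, (G.P_mem i s _).2, one_mul, (hπ s).2]⟩

theorem nonempty_of_mem_occPolytope {v : S i × A i → ℝ} (hv : v ∈ G.occPolytope i) :
    Nonempty (S i × A i) := by
  by_contra h
  rw [not_nonempty_iff] at h
  simpa using hv.2.2

theorem occMarginal_mem {v : S i × A i → ℝ} (hv : v ∈ G.occPolytope i) :
    occMarginal v ∈ stdSimplex ℝ (S i) :=
  ⟨fun s => Finset.sum_nonneg fun a _ => hv.1 _, by
    simp only [occMarginal]; rw [← Fintype.sum_prod_type, hv.2.2]⟩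

theorem sum_transition_mul {v : S i × A i → ℝ} (hv : v ∈ G.occPolytope i) (s' : S i) :
    ∑ z : S i × A i, v z * G.P i z.1 z.2 s' = occMarginal v s' := by
  classical
  have h := hv.2.1 s'
  simp only [sub_mul, Finset.sum_sub_distrib, sub_eq_zero] at h
  simp only [mul_comm (v _)]
  rw [h, Fintype.sum_prod_type, Finset.sum_eq_single s']
  · simp [occMarginal]
  · intro s _ hs; simp [hs]
  · simp

theorem sum_occMarginal_mul_inducedChain [Nonempty (A i)] {v : S i × A i → ℝ}
    (hv : v ∈ G.occPolytope i) (hv0 : ∀ z, 0 < v z) (s' : S i) :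
    ∑ s, occMarginal v s * G.inducedChain i (occPolicy v) s s' = occMarginal v s' := by
  rw [← sum_transition_mul hv s', Fintype.sum_prod_type]
  refine Finset.sum_congr rfl fun s _ => ?_
  rw [inducedChain, Finset.mul_sum]
  refine Finset.sum_congr rfl fun a _ => ?_
  rw [← occMarginal_mul_occPolicy hv0]; ring

/-- Under a mixing bound for all stationary policies, the transition laws of any two state-action
pairs are close: for different states a single deterministic policy compares them, and for two
actions in one state a second state serves as an intermediary. -/
theorem MixingTimeLE.sum_abs_transition_sub_le {τ : ℝ} (hmix : G.MixingTimeLE τ)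
    (z z' : S i × A i) :
    ∑ s, |G.P i z.1 z.2 s - G.P i z'.1 z'.2 s| ≤
      Fintype.card (A i) * Fintype.card (S i) * Real.exp (-1 / τ) := by
  classical
  set κ := Real.exp (-1 / τ) with hκ
  have hκ0 : 0 < κ := Real.exp_pos _
  -- the deterministic policy `f` plays `z.2` in the state `z.1` and `z'.2` in `z'.1`
  have hdiff : ∀ z z' : S i × A i, z.1 ≠ z'.1 →
      ∑ s, |G.P i z.1 z.2 s - G.P i z'.1 z'.2 s| ≤ 2 * κ := by
    intro z z' hne
    let f : S i → A i := fun s => if s = z.1 then z.2 else z'.2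
    have h := hmix i (fun s => Pi.single (f s) 1) (fun s => single_mem_stdSimplex ℝ _)
      (Pi.single z.1 1) (single_mem_stdSimplex ℝ _) (Pi.single z'.1 1) (single_mem_stdSimplex ℝ _)
    have e1 : ∀ s s', G.inducedChain i (fun s => Pi.single (f s) 1) s s' = G.P i s (f s) s' := by
      intro s s'
      simp [inducedChain, Pi.single_apply]
    have e2 : ∑ s, |(Pi.single z.1 1 : S i → ℝ) s - (Pi.single z'.1 1 : S i → ℝ) s| ≤ 2 := by
      calc _ ≤ ∑ s, ((Pi.single z.1 1 : S i → ℝ) s + (Pi.single z'.1 1 : S i → ℝ) s) := by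
            refine Finset.sum_le_sum fun s _ => ?_
            have h1 := (single_mem_stdSimplex ℝ z.1).1 s
            have h2 := (single_mem_stdSimplex ℝ z'.1).1 s
            rw [abs_le]; constructor <;> linarith
        _ = 2 := by
            rw [Finset.sum_add_distrib, (single_mem_stdSimplex ℝ z.1).2,
              (single_mem_stdSimplex ℝ z'.1).2]
            norm_num
    have e3 : ∀ s', ∑ s, ((Pi.single z.1 1 : S i → ℝ) s - (Pi.single z'.1 1 : S i → ℝ) s) *
        G.P i s (f s) s' = G.P i z.1 z.2 s' - G.P i z'.1 z'.2 s' := by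
      intro s'
      simp [sub_mul, Finset.sum_sub_distrib, Pi.single_apply, f, hne.symm]
    simp only [e1, e3] at h
    exact h.trans (by rw [← hκ, mul_comm 2 κ]; exact mul_le_mul_of_nonneg_left e2 hκ0.le)
  have hA : (1 : ℝ) ≤ Fintype.card (A i) := by
    exact_mod_cast Fintype.card_pos_iff.2 ⟨z.2⟩
  have hS : (1 : ℝ) ≤ Fintype.card (S i) := by
    exact_mod_cast Fintype.card_pos_iff.2 ⟨z.1⟩
  by_cases hz : z.1 = z'.1
  · by_cases ha : z.2 = z'.2
    · simp only [hz, ha, sub_self, abs_zero, Finset.sum_const_zero]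
      positivity
    · have hA2 : (2 : ℝ) ≤ Fintype.card (A i) := by
        exact_mod_cast Fintype.one_lt_card_iff.2 ⟨_, _, ha⟩
      by_cases hs : ∃ s, s ≠ z.1
      · obtain ⟨s₁, hs₁⟩ := hs
        have hS2 : (2 : ℝ) ≤ Fintype.card (S i) := by
          exact_mod_cast Fintype.one_lt_card_iff.2 ⟨_, _, hs₁⟩
        have h1 := hdiff z (s₁, z.2) (Ne.symm hs₁)
        have h2 := hdiff (s₁, z.2) z' (hz ▸ hs₁)
        have h3 : ∑ s, |G.P i z.1 z.2 s - G.P i z'.1 z'.2 s| ≤ 2 * κ + 2 * κ := by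
          refine le_trans ?_ (add_le_add h1 h2)
          rw [← Finset.sum_add_distrib]
          exact Finset.sum_le_sum fun s _ => abs_sub_le _ _ _
        refine h3.trans ?_
        have : (4 : ℝ) ≤ Fintype.card (A i) * Fintype.card (S i) := by nlinarith
        nlinarith
      · push Not at hs
        have hone : ∀ z : S i × A i, ∀ s, G.P i z.1 z.2 s = 1 := by
          intro w s
          rw [← (G.P_mem i w.1 w.2).2]
          symm
          exact Finset.sum_eq_single s (fun b _ hb => absurd ((hs b).trans (hs s).symm) hb) (by simp)
        simp only [hone, sub_self, abs_zero, Finset.sum_const_zero]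
        positivity
  · have hS2 : (2 : ℝ) ≤ Fintype.card (S i) := by
      exact_mod_cast Fintype.one_lt_card_iff.2 ⟨_, _, hz⟩
    refine (hdiff z z' hz).trans ?_
    have : (2 : ℝ) ≤ Fintype.card (A i) * Fintype.card (S i) := by nlinarith
    exact mul_le_mul_of_nonneg_right this hκ0.le

/-- The law after one transition from any state-action pair, compared with a stationary law. -/
theorem MixingTimeLE.sum_abs_transition_sub_occMarginal_le {τ : ℝ} (hmix : G.MixingTimeLE τ)
    {v : S i × A i → ℝ} (hv : v ∈ G.occPolytope i) (z : S i × A i) :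
    ∑ s, |G.P i z.1 z.2 s - occMarginal v s| ≤
      Fintype.card (A i) * Fintype.card (S i) * Real.exp (-1 / τ) := by
  have e : ∀ s, G.P i z.1 z.2 s - occMarginal v s =
      ∑ z' : S i × A i, v z' * (G.P i z.1 z.2 s - G.P i z'.1 z'.2 s) := by
    intro s
    simp only [mul_sub, Finset.sum_sub_distrib, ← Finset.sum_mul, hv.2.2, one_mul,
      sum_transition_mul hv]
  calc ∑ s, |G.P i z.1 z.2 s - occMarginal v s|
      ≤ ∑ s, ∑ z' : S i × A i, v z' * |G.P i z.1 z.2 s - G.P i z'.1 z'.2 s| := by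
        refine Finset.sum_le_sum fun s _ => ?_
        rw [e]
        refine (Finset.abs_sum_le_sum_abs _ _).trans_eq (Finset.sum_congr rfl fun z' _ => ?_)
        rw [abs_mul, abs_of_nonneg (hv.1 z')]
    _ = ∑ z' : S i × A i, v z' * ∑ s, |G.P i z.1 z.2 s - G.P i z'.1 z'.2 s| := by
        rw [Finset.sum_comm]; simp only [Finset.mul_sum]
    _ ≤ ∑ z' : S i × A i, v z' *
          (Fintype.card (A i) * Fintype.card (S i) * Real.exp (-1 / τ)) :=
        Finset.sum_le_sum fun z' _ =>
          mul_le_mul_of_nonneg_left (hmix.sum_abs_transition_sub_le z z') (hv.1 z')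
    _ = _ := by rw [← Finset.sum_mul, hv.2.2, one_mul]

/-- The reward of player `i` in the normalization `[-1, 0]`, as a function of the profile of
state-action pairs. -/
def shiftedReward (G : StochasticGame S A) (i : Fin n) (w : ∀ j, S j × A j) : ℝ :=
  G.r i (fun j => (w j).1) (fun j => (w j).2) - 1

theorem shiftedReward_mem (w : ∀ j, S j × A j) : G.shiftedReward i w ∈ Set.Icc (-1 : ℝ) 0 := by
  have := G.r_mem i (fun j => (w j).1) (fun j => (w j).2)
  constructor <;> simp only [shiftedReward] <;> linarith [this.1, this.2]

/-- The partial derivative of the payoff of player `i` (with rewards in `[-1, 0]`) in the direction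
of the coordinate `z` of its own occupation measure. -/
noncomputable def partialPayoff (G : StochasticGame S A) (i : Fin n) (v : OccProfile S A)
    (z : S i × A i) : ℝ :=
  prodExp (Function.update v i (Set.indicator {z} 1)) (G.shiftedReward i)

theorem payoff_eq (v : OccProfile S A) (hv : ∀ j, ∑ z, v j z = 1) :
    G.payoff i v = prodExp v (G.shiftedReward i) + 1 := by
  have h1 : G.payoff i v = prodExp v (fun w => G.shiftedReward i w + 1) := by
    simp only [payoff, prodExp, shiftedReward, sub_add_cancel]
    rw [← Fintype.sum_prod_type']
    exact (Fintype.sum_equiv (Equiv.arrowProdEquivProdArrow _ S A) _ _ fun w => rfl).symm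
  rw [h1, prodExp_add, prodExp_const hv]

theorem nikaidoIsoda_eq {θ v : OccProfile S A} (hθ : ∀ j, ∑ z, θ j z = 1)
    (hv : ∀ j, ∑ z, v j z = 1) :
    G.nikaidoIsoda θ v = ∑ i, ∑ z, (θ i z - v i z) * G.partialPayoff i v z := by
  refine Finset.sum_congr rfl fun i _ => ?_
  have hu : ∀ j, ∑ z, Function.update v i (θ i) j z = 1 := by
    intro j
    by_cases h : j = i
    · subst h; simpa using hθ j
    · rw [Function.update_of_ne h]; exact hv j
  have h2 := prodExp_update v i (v i) (G.shiftedReward i)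
  rw [Function.update_eq_self] at h2
  rw [payoff_eq _ hu, payoff_eq _ hv, add_sub_add_right_eq_sub, prodExp_update, h2,
    ← Finset.sum_sub_distrib]
  exact Finset.sum_congr rfl fun z _ => by rw [partialPayoff]; ring

end StochasticGame

/-! ### Batch times, samples and iterates -/

namespace StochasticGame

variable {n : ℕ} {S A : Fin n → Type*}

section BatchTimes

variable {d : ℕ} {x y : GamePath S A}

theorem coverTime_le_iff {b : ℕ∞} {i : Fin n} {m : ℕ} :
    coverTime d x b i ≤ m ↔
      b + d ≤ m ∧ ∀ σ : S i, ∃ u : ℕ, b + d ≤ u ∧ u ≤ m ∧ (x u).1 i = σ := by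
  constructor
  · intro h
    have hne : {t : ℕ∞ | ∃ m : ℕ, t = m ∧ b + d ≤ m ∧
        ∀ σ : S i, ∃ u : ℕ, b + d ≤ u ∧ u ≤ m ∧ (x u).1 i = σ}.Nonempty := by
      by_contra he
      rw [Set.not_nonempty_iff_eq_empty] at he
      rw [coverTime, he, sInf_empty, top_le_iff] at h
      exact ENat.natCast_ne_top m h
    obtain ⟨m₀, hm₀, hb, hv⟩ := csInf_mem hne
    rw [coverTime, hm₀, Nat.cast_le] at h
    refine ⟨hb.trans (Nat.cast_le.2 h), fun σ => ?_⟩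
    obtain ⟨u, hu, hum, hx⟩ := hv σ
    exact ⟨u, hu, hum.trans h, hx⟩
  · rintro ⟨hb, hv⟩
    exact sInf_le ⟨m, rfl, hb, hv⟩

theorem add_le_coverTime (b : ℕ∞) (i : Fin n) : b + d ≤ coverTime d x b i := by
  refine le_sInf ?_
  rintro _ ⟨m, rfl, h, -⟩
  exact h

theorem batchTime_succ_le_iff {k : ℕ} (hk : 1 ≤ k) {m : ℕ∞} :
    batchTime d x (k + 1) ≤ m ↔ ∀ i, coverTime d x (batchTime d x k) i ≤ m := by
  obtain ⟨k, rfl⟩ := Nat.exists_eq_add_of_le' hk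
  simp [batchTime]

theorem batchTime_add_le [Nonempty (Fin n)] {k : ℕ} (hk : 1 ≤ k) :
    batchTime d x k + d ≤ batchTime d x (k + 1) := by
  obtain ⟨i⟩ := ‹Nonempty (Fin n)›
  exact (add_le_coverTime _ i).trans ((batchTime_succ_le_iff hk).1 le_rfl i)

theorem batchTime_mono [Nonempty (Fin n)] {k l : ℕ} (hk : 1 ≤ k) (hkl : k ≤ l) :
    batchTime d x k ≤ batchTime d x l := by
  induction l, hkl using Nat.le_induction with
  | base => exact le_rfl
  | succ l hl ih => exact ih.trans (le_self_add.trans (batchTime_add_le (hk.trans hl)))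

/-- The batch times are stopping times: whether `τ^k ≤ m`, and the value of `τ^k` in that case, is
determined by the trajectory up to time `m`. -/
theorem batchTime_congr [Nonempty (Fin n)] {m : ℕ} (hxy : ∀ t ≤ m, x t = y t) {k : ℕ}
    (hk : 1 ≤ k) (hm : batchTime d x k ≤ m) : batchTime d y k = batchTime d x k := by
  induction k, hk using Nat.le_induction with
  | base => rfl
  | succ k hk ih =>
    have hb : batchTime d y k = batchTime d x k :=
      ih ((batchTime_mono hk (Nat.le_succ k)).trans hm)
    have key : ∀ m' : ℕ, m' ≤ m →
        (batchTime d x (k + 1) ≤ m' ↔ batchTime d y (k + 1) ≤ m') := by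
      intro m' hm'
      rw [batchTime_succ_le_iff hk, batchTime_succ_le_iff hk, hb]
      refine forall_congr' fun i => ?_
      rw [coverTime_le_iff, coverTime_le_iff]
      refine and_congr_right fun _ => forall_congr' fun σ => exists_congr fun u => ?_
      refine and_congr_right fun _ => and_congr_right fun hu => ?_
      rw [hxy u (hu.trans hm')]
    obtain ⟨a, ha⟩ := ENat.ne_top_iff_exists.1 (ne_top_of_le_ne_top (ENat.natCast_ne_top m) hm)
    have ham : a ≤ m := by rw [← ha] at hm; exact_mod_cast hm
    have h1 : batchTime d y (k + 1) ≤ a := (key a ham).1 ha.ge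
    obtain ⟨c, hc⟩ := ENat.ne_top_iff_exists.1 (ne_top_of_le_ne_top (ENat.natCast_ne_top a) h1)
    have hca : c ≤ a := by rw [← hc] at h1; exact_mod_cast h1
    have h2 : batchTime d x (k + 1) ≤ c := (key c (hca.trans ham)).2 hc.ge
    exact le_antisymm (h1.trans ha.le) (h2.trans hc.le)

theorem batchIndex_eq [Nonempty (Fin n)] {k t : ℕ} (hk : 1 ≤ k) (ht : batchTime d x k < t)
    (ht' : t ≤ batchTime d x (k + 1)) : batchIndex d x t = k := by
  refine le_antisymm (Nat.sInf_le ⟨hk, ht'⟩) (le_csInf ⟨k, hk, ht'⟩ ?_)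
  rintro l ⟨hl, hlt⟩
  by_contra! hlk
  exact absurd (hlt.trans (batchTime_mono (by omega) hlk)) (not_le.2 ht)

open Classical in
/-- The joint state and action at the first visit of player `i` to its state `s` in the sampling
phase of batch `k`, and `none` if there is no such visit. -/
noncomputable def firstSample (d : ℕ) (x : GamePath S A) (k : ℕ) (i : Fin n) (s : S i) :
    Option ((∀ i, S i) × (∀ i, A i)) :=
  if h : ∃ t, (batchTime d x k).toNat + d ≤ t ∧ (x t).1 i = s then some (x (Nat.find h)) else none

theorem firstSample_eq_some_iff {k : ℕ} {i : Fin n} {s : S i} {w : (∀ i, S i) × (∀ i, A i)} :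
    firstSample d x k i s = some w ↔ ∃ t, (batchTime d x k).toNat + d ≤ t ∧ x t = w ∧ w.1 i = s ∧
      ∀ u, (batchTime d x k).toNat + d ≤ u → u < t → (x u).1 i ≠ s := by
  classical
  constructor
  · intro h
    rw [firstSample] at h
    split_ifs at h with hex
    simp only [Option.some.injEq] at h
    have hs := Nat.find_spec hex
    exact ⟨_, hs.1, h, h ▸ hs.2, fun u hu hut hus => Nat.find_min hex hut ⟨hu, hus⟩⟩
  · rintro ⟨t, ht, rfl, hs, hmin⟩
    have hex : ∃ t, (batchTime d x k).toNat + d ≤ t ∧ (x t).1 i = s := ⟨t, ht, hs⟩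
    rw [firstSample, dif_pos hex, (Nat.find_eq_iff hex).2 ⟨⟨ht, hs⟩, fun u hut hu =>
      hmin u hu.1 hut hu.2⟩]

end BatchTimes

variable [∀ i, Fintype (S i)] [∀ i, Fintype (A i)] (G : StochasticGame S A)

section Estimator

variable {d : ℕ} {x y : GamePath S A} {k : ℕ}

open Classical in
/-- The coordinate `z` of the estimator of player `i`, given the sample at the state `z.1`. -/
noncomputable def sampleValue (i : Fin n) (π : S i → A i → ℝ) (z : S i × A i) :
    Option ((∀ i, S i) × (∀ i, A i)) → ℝ
  | none => 0
  | some w => if w.2 i = z.2 then (G.r i w.1 w.2 - 1) / π z.1 z.2 else 0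

/-- The sum that defines the estimator of a batch that never ends runs over an empty interval,
because `⊤.toNat = 0`. -/
theorem estimator_of_eq_top (hd : 1 ≤ d) (hk : batchTime d x (k + 1) = ⊤) (i : Fin n)
    (π : S i → A i → ℝ) (z : S i × A i) : G.estimator d x k i π z = 0 := by
  rw [estimator, hk, Finset.Icc_eq_empty, Finset.sum_empty]
  rw [ENat.toNat_top]; omega

theorem estimator_eq_sampleValue [Nonempty (Fin n)] (hk1 : 1 ≤ k)
    (hk : batchTime d x (k + 1) ≠ ⊤) (i : Fin n)
    (π : S i → A i → ℝ) (z : S i × A i) :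
    G.estimator d x k i π z = G.sampleValue i π z (firstSample d x k i z.1) := by
  classical
  have hkt : batchTime d x k ≠ ⊤ :=
    ne_top_of_le_ne_top hk (batchTime_mono hk1 (Nat.le_succ k))
  obtain ⟨b, hb⟩ := ENat.ne_top_iff_exists.1 hkt
  obtain ⟨e, he⟩ := ENat.ne_top_iff_exists.1 hk
  have hvis := (coverTime_le_iff.1 ((batchTime_succ_le_iff hk1).1 he.ge i)).2 z.1
  rw [← hb] at hvis
  obtain ⟨u, hbu, hue, hus⟩ := hvis
  have hbu' : b + d ≤ u := by exact_mod_cast hbu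
  have hex : ∃ t, (batchTime d x k).toNat + d ≤ t ∧ (x t).1 i = z.1 :=
    ⟨u, by rw [← hb]; exact hbu', hus⟩
  obtain ⟨w, hw⟩ : ∃ w, firstSample d x k i z.1 = some w := ⟨_, dif_pos hex⟩
  obtain ⟨t, ht, hxt, hws, hmin⟩ := firstSample_eq_some_iff.1 hw
  rw [hw, sampleValue, estimator, Finset.sum_eq_single t]
  · subst hxt
    by_cases ha : (x t).2 i = z.2
    · rw [if_pos ha, if_pos ⟨fun u hu hut => hws ▸ hmin u hu hut, Prod.ext hws.symm ha.symm⟩,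
        hws, ha]
    · rw [if_neg ha, if_neg]
      exact fun h => ha (congrArg Prod.snd h.2).symm
  · intro t' ht' hne
    refine if_neg fun ⟨h1, h2⟩ => hne ?_
    have hzs : (x t').1 i = z.1 := (congrArg Prod.fst h2).symm
    rcases lt_trichotomy t' t with h | h | h
    · exact absurd hzs (hmin t' (Finset.mem_Icc.1 ht').1 h)
    · exact h
    · exact absurd (by rw [hxt, hws, hzs]) (h1 t ht h)
  · intro ht'
    exfalso
    apply ht'
    rw [Finset.mem_Icc]
    refine ⟨ht, ?_⟩
    rw [← he, ENat.toNat_natCast]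
    by_contra! hlt
    exact hmin u (by rw [← hb]; exact hbu') (hue.trans_lt hlt) hus

theorem estimator_congr [Nonempty (Fin n)] {m : ℕ} (hxy : ∀ t ≤ m, x t = y t) (hk1 : 1 ≤ k)
    (hm : batchTime d x (k + 1) ≤ m) (i : Fin n) (π : S i → A i → ℝ) (z : S i × A i) :
    G.estimator d y k i π z = G.estimator d x k i π z := by
  have h1 := batchTime_congr hxy hk1 ((batchTime_mono hk1 (Nat.le_succ k)).trans hm)
  have h2 := batchTime_congr hxy (Nat.le_succ_of_le hk1) hm
  obtain ⟨e, he⟩ := ENat.ne_top_iff_exists.1 (ne_top_of_le_ne_top (ENat.natCast_ne_top m) hm)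
  have hem : e ≤ m := by rw [← he] at hm; exact_mod_cast hm
  rw [estimator, estimator, h1, h2]
  refine Finset.sum_congr rfl fun t ht => ?_
  have htm : t ≤ m := by
    rw [Finset.mem_Icc, ← he, ENat.toNat_natCast] at ht; exact ht.2.trans hem
  rw [← hxy t htm]
  classical
  refine if_congr (and_congr_left' ?_) rfl rfl
  refine forall_congr' fun u => forall_congr' fun _ => forall_congr' fun hu => ?_
  rw [hxy u (hu.le.trans htm)]

end Estimator

section Iterates

variable {G} {d : ℕ} {η : ℕ → ℝ} {ρ₁ : OccProfile S A} {ρ : ℕ → GamePath S A → OccProfile S A}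
  (hρ₁ : ∀ i, ρ₁ i ∈ G.occPolytope i) (hρ₁0 : ∀ i z, 0 < ρ₁ i z)
  (hρ : G.IsKLMirrorDescent d η ρ₁ ρ)
include hρ₁ hρ₁0 hρ

theorem IsKLMirrorDescent.mem_pos {k : ℕ} (hk : 1 ≤ k) (x : GamePath S A) (i : Fin n) :
    ρ k x i ∈ G.occPolytope i ∧ ∀ z, 0 < ρ k x i z := by
  induction k, hk using Nat.le_induction with
  | base => rw [hρ.1]; exact ⟨hρ₁ i, hρ₁0 i⟩
  | succ k hk ih =>
    have h := (hρ.2 k hk x i).gibbs_projection (G.convex_occPolytope i) (G.occPolytope_subset i)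
      (hρ₁ i) (hρ₁0 i) ih.2 ih.1.2.2
    exact ⟨h.1, h.2.1⟩

theorem IsKLMirrorDescent.succ_congr {k : ℕ} (hk : 1 ≤ k) {x y : GamePath S A}
    (h : ρ k x = ρ k y)
    (hR : ∀ i z, G.estimator d x k i (occPolicy (ρ k x i)) z =
      G.estimator d y k i (occPolicy (ρ k x i)) z) : ρ (k + 1) x = ρ (k + 1) y := by
  funext i
  have hx := hρ.2 k hk x i
  have hy := hρ.2 k hk y i
  rw [← h] at hy
  simp only [← hR] at hy
  have hm := hρ.mem_pos hρ₁ hρ₁0 hk x i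
  exact hy.unique (G.convex_occPolytope i) (G.occPolytope_subset i) (hρ₁ i) (hρ₁0 i) hm.2
    hm.1.2.2 hx

/-- The iterate of batch `k` is determined by the history up to the beginning of the batch. -/
theorem IsKLMirrorDescent.congr [Nonempty (Fin n)] {k : ℕ} (hk : 1 ≤ k) {x y : GamePath S A}
    {m : ℕ} (hxy : ∀ t ≤ m, x t = y t) (hm : batchTime d x k ≤ m) : ρ k x = ρ k y := by
  induction k, hk using Nat.le_induction with
  | base => rw [hρ.1, hρ.1]
  | succ k hk ih =>
    refine hρ.succ_congr hρ₁ hρ₁0 hk (ih ((batchTime_mono hk (Nat.le_succ k)).trans hm))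
      fun i z => ?_
    exact (G.estimator_congr hxy hk hm i _ z).symm

/-- The iterates take finitely many values: each update depends only on the previous iterate and
on the samples, which lie in a finite set. -/
theorem IsKLMirrorDescent.finite_range [Nonempty (Fin n)] (hd : 1 ≤ d) {k : ℕ} (hk : 1 ≤ k) :
    (Set.range (ρ k)).Finite := by
  induction k, hk using Nat.le_induction with
  | base =>
    refine (Set.finite_singleton ρ₁).subset ?_
    rintro _ ⟨x, rfl⟩
    exact hρ.1 x
  | succ k hk ih =>
    classical
    let D : GamePath S A → Set.range (ρ k) × Prop × (∀ i, S i → Option ((∀ i, S i) × (∀ i, A i))) :=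
      fun x => (⟨ρ k x, x, rfl⟩, batchTime d x (k + 1) = ⊤, fun i s => firstSample d x k i s)
    have := ih.to_subtype
    have hD : ∀ x y, D x = D y → ρ (k + 1) x = ρ (k + 1) y := by
      intro x y hxy
      simp only [D, Prod.mk.injEq, eq_iff_iff] at hxy
      obtain ⟨h1, h2, h3⟩ := hxy
      refine hρ.succ_congr hρ₁ hρ₁0 hk (congrArg Subtype.val h1) fun i z => ?_
      by_cases ht : batchTime d x (k + 1) = ⊤
      · rw [G.estimator_of_eq_top hd ht, G.estimator_of_eq_top hd (h2.1 ht)]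
      · rw [G.estimator_eq_sampleValue hk ht, G.estimator_eq_sampleValue hk (fun h => ht (h2.2 h)),
          congrFun (congrFun h3 i) z.1]
    have hsub : Set.range (ρ (k + 1)) ⊆
        Set.range (fun c => if h : ∃ x, D x = c then ρ (k + 1) h.choose else ρ₁) := by
      rintro _ ⟨x, rfl⟩
      have hex : ∃ y, D y = D x := ⟨x, rfl⟩
      exact ⟨D x, by simp only [dif_pos hex]; exact hD _ _ hex.choose_spec⟩
    exact (Set.finite_range _).subset hsub

end Iterates

end StochasticGame

/-! ### The Markov property of the play -/

section MeasureReal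

variable {Ω : Type*} [MeasurableSpace Ω] {μ : Measure Ω} [IsFiniteMeasure μ]

theorem hasSum_measureReal_iUnion {ι : Type*} [Countable ι] {s : ι → Set Ω}
    (hd : Pairwise (Function.onFun Disjoint s)) (hs : ∀ i, MeasurableSet (s i)) :
    HasSum (fun i => μ.real (s i)) (μ.real (⋃ i, s i)) := by
  have h : ∑' i, μ (s i) ≠ ⊤ := by rw [← measure_iUnion hd hs]; exact measure_ne_top _ _
  simp only [measureReal_def]
  rw [measure_iUnion hd hs, ENNReal.tsum_toReal_eq fun i => measure_ne_top _ _]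
  exact ENNReal.hasSum_toReal h

theorem measureReal_eq_sum_fibers {β : Type*} [Fintype β] {B : Set Ω} (hB : MeasurableSet B)
    {f : Ω → β} (hf : ∀ b, MeasurableSet {ω | f ω = b}) :
    μ.real B = ∑ b, μ.real {ω | ω ∈ B ∧ f ω = b} := by
  rw [← measureReal_iUnion_fintype (f := fun b => {ω | ω ∈ B ∧ f ω = b})]
  · congr 1; ext ω; simp
  · intro b b' hne
    refine Set.disjoint_left.2 fun ω h1 h2 => hne ?_
    exact h1.2.symm.trans h2.2
  · exact fun b => hB.inter (hf b)

end MeasureReal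

namespace StochasticGame

variable {n : ℕ} {S A : Fin n → Type*}

/-- A set of trajectories that is determined by the coordinates up to time `T`. -/
def DependsUpTo (T : ℕ) (E : Set (GamePath S A)) : Prop :=
  ∀ x y : GamePath S A, (∀ t ≤ T, x t = y t) → x ∈ E → y ∈ E

/-- The trajectory that follows a finite one and then stays at its last point. -/
def extendPath {T : ℕ} (p : Fin (T + 1) → (∀ i, S i) × (∀ i, A i)) : GamePath S A :=
  fun t => p ⟨min t T, by omega⟩

theorem extendPath_apply {T : ℕ} (p : Fin (T + 1) → (∀ i, S i) × (∀ i, A i)) {t : ℕ}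
    (ht : t ≤ T) : extendPath p t = p ⟨t, by omega⟩ := by
  simp [extendPath, ht]

theorem extendPath_restrict {T : ℕ} (x : GamePath S A)
    {p : Fin (T + 1) → (∀ i, S i) × (∀ i, A i)} (h : (fun t : Fin (T + 1) => x t) = p) :
    ∀ t ≤ T, x t = extendPath p t := by
  intro t ht
  rw [extendPath_apply p ht, ← h]

variable [∀ i, Fintype (S i)] [∀ i, Fintype (A i)] {G : StochasticGame S A} {d : ℕ}
  {ρ : ℕ → GamePath S A → OccProfile S A} {s₀ : ∀ i, S i} {Ω : Type*} [MeasurableSpace Ω]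
  {μ : Measure Ω} {X : ℕ → Ω → (∀ i, S i) × (∀ i, A i)}

section Measurability

variable (hX : ∀ t z, MeasurableSet {ω | X t ω = z})
include hX

omit [∀ i, Fintype (S i)] [∀ i, Fintype (A i)] in
theorem measurableSet_prefix (T : ℕ) (p : Fin (T + 1) → (∀ i, S i) × (∀ i, A i)) :
    MeasurableSet {ω | (fun t : Fin (T + 1) => X t ω) = p} := by
  simp only [funext_iff, Set.ofPred_forall]
  exact MeasurableSet.iInter fun t => hX t (p t)

theorem DependsUpTo.measurableSet {T : ℕ} {E : Set (GamePath S A)} (hE : DependsUpTo T E) :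
    MeasurableSet {ω | (fun t => X t ω) ∈ E} := by
  have : {ω | (fun t => X t ω) ∈ E} =
      ⋃ p : {p : Fin (T + 1) → (∀ i, S i) × (∀ i, A i) // extendPath p ∈ E},
        {ω | (fun t : Fin (T + 1) => X t ω) = p} := by
    ext ω
    simp only [Set.mem_iUnion]
    constructor
    · intro h
      exact ⟨⟨_, hE _ _ (extendPath_restrict _ rfl) h⟩, rfl⟩
    · rintro ⟨⟨p, hp⟩, h⟩
      exact hE _ _ (fun t ht => (extendPath_restrict (fun t => X t ω) h t ht).symm) hp
  rw [this]
  exact MeasurableSet.iUnion fun p => measurableSet_prefix hX T p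

end Measurability

/-- The probability of moving from the joint state and action `w` to `w'` in one step, when the
actions at `w'` follow the policies of the occupation measures `v`. -/
noncomputable def stepProb (G : StochasticGame S A) (v : OccProfile S A)
    (w w' : (∀ i, S i) × (∀ i, A i)) : ℝ :=
  (∏ i, G.P i (w.1 i) (w.2 i) (w'.1 i)) * ∏ i, occPolicy (v i) (w'.1 i) (w'.2 i)

variable [IsFiniteMeasure μ] (hX : G.IsPlay d ρ s₀ μ X)
include hX

omit [IsFiniteMeasure μ] in
theorem IsPlay.measureReal_cylinder_succ (T : ℕ) (x : GamePath S A)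
    (hnn : 0 ≤ G.stepProb (ρ (batchIndex d x (T + 1)) x) (x T) (x (T + 1))) :
    μ.real {ω | ∀ t ≤ T + 1, X t ω = x t} =
      G.stepProb (ρ (batchIndex d x (T + 1)) x) (x T) (x (T + 1)) *
        μ.real {ω | ∀ t ≤ T, X t ω = x t} := by
  rw [measureReal_def, measureReal_def, hX.2, hX.2, Finset.prod_range_succ _ (T + 1),
    Finset.prod_range_succ (fun t => ∏ i, G.P i ((x t).1 i) ((x t).2 i) ((x (t + 1)).1 i)) T]
  -- only the last factor has to be nonnegative for `ENNReal.ofReal` to be multiplicative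
  rw [← ENNReal.toReal_ofReal hnn, ← ENNReal.toReal_mul, ← ENNReal.ofReal_mul hnn]
  congr 2
  rw [stepProb]
  ring

/-- The Markov property of the play, on an event of the past on which the policies in force at the
next time are known. -/
theorem IsPlay.measureReal_step {T : ℕ} {E : Set (GamePath S A)} (hE : DependsUpTo T E)
    {v : OccProfile S A} (hv : ∀ x ∈ E, ρ (batchIndex d x (T + 1)) x = v)
    (w w' : (∀ i, S i) × (∀ i, A i)) (hnn : 0 ≤ G.stepProb v w w') :
    μ.real {ω | ((fun t => X t ω) ∈ E ∧ X T ω = w) ∧ X (T + 1) ω = w'} =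
      G.stepProb v w w' * μ.real {ω | (fun t => X t ω) ∈ E ∧ X T ω = w} := by
  classical
  have hEm := hE.measurableSet hX.1
  have hB : MeasurableSet {ω | (fun t => X t ω) ∈ E ∧ X T ω = w} := hEm.inter (hX.1 T w)
  have hB' : MeasurableSet {ω | ((fun t => X t ω) ∈ E ∧ X T ω = w) ∧ X (T + 1) ω = w'} :=
    hB.inter (hX.1 (T + 1) w')
  rw [measureReal_eq_sum_fibers hB (measurableSet_prefix hX.1 T),
    measureReal_eq_sum_fibers hB' (measurableSet_prefix hX.1 T), Finset.mul_sum]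
  refine Finset.sum_congr rfl fun p _ => ?_
  by_cases hp : extendPath p ∈ E ∧ extendPath p T = w
  · set y : GamePath S A := Function.update (extendPath p) (T + 1) w' with hy
    have hyT : ∀ t ≤ T, extendPath p t = y t := fun t ht => by
      rw [hy, Function.update_of_ne (by omega)]
    have hyE : y ∈ E := hE _ _ hyT hp.1
    have hyw : y T = w := by rw [← hyT T le_rfl, hp.2]
    have hyw' : y (T + 1) = w' := by rw [hy, Function.update_self]
    have hcyl := hX.measureReal_cylinder_succ T y (by rw [hv y hyE, hyw, hyw']; exact hnn)
    rw [hv y hyE, hyw, hyw'] at hcyl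
    have e1 : {ω | ω ∈ {ω | (fun t => X t ω) ∈ E ∧ X T ω = w} ∧
        (fun t : Fin (T + 1) => X t ω) = p} = {ω | ∀ t ≤ T, X t ω = y t} := by
      ext ω
      constructor
      · rintro ⟨-, h⟩ t ht
        exact (extendPath_restrict (fun t => X t ω) h t ht).trans (hyT t ht)
      · intro h
        refine ⟨⟨hE y _ (fun t ht => (h t ht).symm) hyE, (h T le_rfl).trans hyw⟩, ?_⟩
        funext t
        rw [h t (by omega), ← hyT t (by omega), extendPath_apply p (by omega)]
    have e2 : {ω | ω ∈ {ω | ((fun t => X t ω) ∈ E ∧ X T ω = w) ∧ X (T + 1) ω = w'} ∧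
        (fun t : Fin (T + 1) => X t ω) = p} = {ω | ∀ t ≤ T + 1, X t ω = y t} := by
      ext ω
      constructor
      · rintro ⟨⟨-, h'⟩, h⟩ t ht
        rcases Nat.le_succ_iff.1 ht with ht | rfl
        · exact (extendPath_restrict (fun t => X t ω) h t ht).trans (hyT t ht)
        · exact h'.trans hyw'.symm
      · intro h
        have h2 : ω ∈ {ω | ∀ t ≤ T, X t ω = y t} := fun t ht => h t (by omega)
        rw [← e1] at h2
        exact ⟨⟨h2.1, (h _ le_rfl).trans hyw'⟩, h2.2⟩
    rw [e1, e2, hcyl]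
  · have hempty : ∀ ω, ¬ (((fun t => X t ω) ∈ E ∧ X T ω = w) ∧
        (fun t : Fin (T + 1) => X t ω) = p) := by
      rintro ω ⟨⟨h1, h2⟩, h3⟩
      have := extendPath_restrict (fun t => X t ω) h3
      exact hp ⟨hE _ _ this h1, (this T le_rfl).symm.trans h2⟩
    have e1 : {ω | ω ∈ {ω | (fun t => X t ω) ∈ E ∧ X T ω = w} ∧
        (fun t : Fin (T + 1) => X t ω) = p} = ∅ :=
      Set.eq_empty_iff_forall_notMem.2 fun ω h => hempty ω h
    have e2 : {ω | ω ∈ {ω | ((fun t => X t ω) ∈ E ∧ X T ω = w) ∧ X (T + 1) ω = w'} ∧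
        (fun t : Fin (T + 1) => X t ω) = p} = ∅ :=
      Set.eq_empty_iff_forall_notMem.2 fun ω h => hempty ω ⟨h.1.1, h.2⟩
    rw [e1, e2]; simp

end StochasticGame

/-! ### The law of a batch given its history -/

namespace StochasticGame

variable {n : ℕ} {S A : Fin n → Type*}

/-- The trajectories that agree with `h` up to time `b` and on which player `i` does not visit `s`
at the times in `[b + d, b + m]`. -/
def avoidSet (d : ℕ) (h : GamePath S A) (b : ℕ) (i : Fin n) (s : S i) (m : ℕ) :
    Set (GamePath S A) :=
  {x | (∀ t ≤ b, x t = h t) ∧ ∀ u, b + d ≤ u → u ≤ b + m → (x u).1 i ≠ s}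

section Avoid

variable {d : ℕ} {h : GamePath S A} {b : ℕ} {i : Fin n} {s : S i}

theorem dependsUpTo_avoidSet (m : ℕ) : DependsUpTo (b + m) (avoidSet d h b i s m) := by
  rintro x y hxy ⟨h1, h2⟩
  refine ⟨fun t ht => ?_, fun u hu hum => ?_⟩
  · rw [← hxy t (by omega), h1 t ht]
  · rw [← hxy u hum]; exact h2 u hu hum

theorem mem_avoidSet_succ {x : GamePath S A} {m : ℕ} :
    x ∈ avoidSet d h b i s (m + 1) ↔
      x ∈ avoidSet d h b i s m ∧ ¬ (d ≤ m + 1 ∧ (x (b + m + 1)).1 i = s) := by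
  constructor
  · rintro ⟨h1, h2⟩
    exact ⟨⟨h1, fun u hu hum => h2 u hu (by omega)⟩, fun ⟨h3, h4⟩ =>
      h2 _ (by omega) (by omega) h4⟩
  · rintro ⟨⟨h1, h2⟩, h3⟩
    refine ⟨h1, fun u hu hum h4 => ?_⟩
    rcases Nat.lt_or_ge (b + m) u with hlt | hle
    · obtain rfl : u = b + m + 1 := by omega
      exact h3 ⟨by omega, h4⟩
    · exact h2 u hu hle h4

theorem mem_avoidSet_zero (hd : 1 ≤ d) {x : GamePath S A} :
    x ∈ avoidSet d h b i s 0 ↔ ∀ t ≤ b, x t = h t :=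
  ⟨fun hx => hx.1, fun hx => ⟨hx, fun u hu hub => by omega⟩⟩

variable [Nonempty (Fin n)] {ℓ : ℕ} (hℓ : 1 ≤ ℓ) (hb : batchTime d h ℓ = b)
include hℓ hb

theorem batchTime_of_agree {x : GamePath S A} (hx : ∀ t ≤ b, x t = h t) :
    batchTime d x ℓ = b := by
  rw [← hb]
  exact batchTime_congr (fun t ht => (hx t ht).symm) hℓ hb.le

/-- While a state has not been sampled the batch goes on. -/
theorem batchIndex_of_mem_avoidSet {x : GamePath S A} {m : ℕ}
    (hx : x ∈ avoidSet d h b i s m) : batchIndex d x (b + m + 1) = ℓ := by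
  have hbx := batchTime_of_agree hℓ hb hx.1
  refine batchIndex_eq hℓ ?_ ?_
  · rw [hbx]; exact_mod_cast (by omega : b < b + m + 1)
  · by_contra! hlt
    have hle : batchTime d x (ℓ + 1) ≤ (b + m : ℕ) := by
      refine Order.le_of_lt_add_one ?_
      exact_mod_cast hlt
    obtain ⟨u, hu, hum, hus⟩ := (coverTime_le_iff.1 ((batchTime_succ_le_iff hℓ).1 hle i)).2 s
    rw [hbx] at hu
    exact hx.2 u (by exact_mod_cast hu) hum hus

/-- A batch goes on forever only if some player never visits one of its states. -/
theorem exists_mem_avoidSet_of_batchTime_eq_top [∀ i, Fintype (S i)] {x : GamePath S A}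
    (hx : ∀ t ≤ b, x t = h t) (htop : batchTime d x (ℓ + 1) = ⊤) :
    ∃ (i : Fin n) (s : S i), ∀ m, x ∈ avoidSet d h b i s m := by
  by_contra! hne
  have hvis : ∀ z : (Σ i, S i), ∃ u, b + d ≤ u ∧ (x u).1 z.1 = z.2 := by
    rintro ⟨i, s⟩
    obtain ⟨m, hm⟩ := hne i s
    simp only [avoidSet, Set.mem_ofPred_eq, not_and] at hm
    have := hm hx
    push Not at this
    obtain ⟨u, hu, -, hus⟩ := this
    exact ⟨u, hu, hus⟩
  choose u hu hus using hvis
  have hbx := batchTime_of_agree hℓ hb hx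
  have : batchTime d x (ℓ + 1) ≤ ((b + d + ∑ z, u z : ℕ) : ℕ∞) := by
    rw [batchTime_succ_le_iff hℓ]
    intro i
    rw [coverTime_le_iff, hbx]
    refine ⟨by exact_mod_cast Nat.le_add_right _ _, fun σ => ⟨u ⟨i, σ⟩, by exact_mod_cast hu _, ?_,
      hus ⟨i, σ⟩⟩⟩
    exact (Finset.single_le_sum (f := u) (fun _ _ => Nat.zero_le _) (Finset.mem_univ _)).trans
      (Nat.le_add_left _ _)
  rw [htop, top_le_iff] at this
  exact ENat.natCast_ne_top _ this

end Avoid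

variable [∀ i, Fintype (S i)] [∀ i, Fintype (A i)] {G : StochasticGame S A} {d : ℕ}

/-- The laws of the players' state-action pairs at time `b + m + 1`, for a batch that begins at
time `b` in the joint state and action `z`, while player `i` avoids the state `s` from time `b + d`
on: the chain of player `i` is killed at `s`, the other chains are not. -/
noncomputable def avoidLaw (G : StochasticGame S A) (d : ℕ) (v : OccProfile S A)
    (z : (∀ i, S i) × (∀ i, A i)) (i : Fin n) (s : S i) (m : ℕ) : OccProfile S A :=
  fun j => pairLaw (killedLaw (G.inducedChain j (occPolicy (v j)))
    (Function.update (fun j => (∅ : Set (S j))) i {s} j) d (G.P j (z.1 j) (z.2 j)) m)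
    (occPolicy (v j))

theorem sum_pair_eq_sum_pi (f : (∀ i, S i) × (∀ i, A i) → ℝ) :
    ∑ w, f w = ∑ w : ∀ j, S j × A j, f (fun j => (w j).1, fun j => (w j).2) :=
  (Fintype.sum_equiv (Equiv.arrowProdEquivProdArrow _ S A) _ _ fun _ => rfl).symm

theorem sum_stepProb_mul_avoidLaw (v : OccProfile S A) (z : (∀ i, S i) × (∀ i, A i)) (i : Fin n)
    (s : S i) (m : ℕ) (w' : (∀ i, S i) × (∀ i, A i)) [∀ w : (∀ i, S i) × (∀ i, A i),
      Decidable (d ≤ m + 1 ∧ w.1 i = s)] :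
    ∑ w : (∀ i, S i) × (∀ i, A i), G.stepProb v w w' *
        (if d ≤ m + 1 ∧ w.1 i = s then 0 else ∏ j, G.avoidLaw d v z i s m j (w.1 j, w.2 j)) =
      ∏ j, G.avoidLaw d v z i s (m + 1) j (w'.1 j, w'.2 j) := by
  classical
  set B : ∀ j, Set (S j) := Function.update (fun j => (∅ : Set (S j))) i {s} with hB
  set q : ∀ j, S j → ℝ := fun j => killedLaw (G.inducedChain j (occPolicy (v j))) (B j) d
    (G.P j (z.1 j) (z.2 j)) m with hq
  set F : ∀ j, S j × A j → ℝ := fun j c => (if d ≤ m + 1 ∧ c.1 ∈ B j then 0 else q j c.1) *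
    (G.P j c.1 c.2 (w'.1 j) * occPolicy (v j) c.1 c.2) with hF
  have hterm : ∀ w : (∀ i, S i) × (∀ i, A i), G.stepProb v w w' *
      (if d ≤ m + 1 ∧ w.1 i = s then 0 else ∏ j, G.avoidLaw d v z i s m j (w.1 j, w.2 j)) =
      (∏ j, F j (w.1 j, w.2 j)) * ∏ j, occPolicy (v j) (w'.1 j) (w'.2 j) := by
    intro w
    by_cases hw : d ≤ m + 1 ∧ w.1 i = s
    · rw [if_pos hw, Finset.prod_eq_zero (Finset.mem_univ i), mul_zero, zero_mul]
      simp [hF, hB, hw.1, hw.2]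
    · have hne : ∀ j, ¬ (d ≤ m + 1 ∧ w.1 j ∈ B j) := by
        rintro j ⟨h1, h2⟩
        by_cases hj : j = i
        · subst hj
          rw [hB, Function.update_self] at h2
          exact hw ⟨h1, h2⟩
        · rw [hB, Function.update_of_ne hj] at h2
          exact h2
      rw [if_neg hw, stepProb]
      simp only [hF, if_neg (hne _), avoidLaw, pairLaw, ← hB, Finset.prod_mul_distrib, hq]
      ring
  simp only [hterm]
  rw [← Finset.sum_mul, sum_pair_eq_sum_pi fun w => ∏ j, F j (w.1 j, w.2 j)]
  simp only [Prod.mk.eta]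
  rw [sum_prod_apply, ← Finset.prod_mul_distrib]
  refine Finset.prod_congr rfl fun j _ => ?_
  simp only [avoidLaw, pairLaw, ← hB]
  congr 1
  rw [Fintype.sum_prod_type]
  simp only [killedLaw, hF, ← Finset.mul_sum, inducedChain, hq]

variable [Nonempty (Fin n)] {η : ℕ → ℝ} {ρ₁ : OccProfile S A}
  {ρ : ℕ → GamePath S A → OccProfile S A} {s₀ : ∀ i, S i} {Ω : Type*} [MeasurableSpace Ω]
  {μ : Measure Ω} [IsFiniteMeasure μ] {X : ℕ → Ω → (∀ i, S i) × (∀ i, A i)}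
  (hρ₁ : ∀ i, ρ₁ i ∈ G.occPolytope i) (hρ₁0 : ∀ i z, 0 < ρ₁ i z)
  (hρ : G.IsKLMirrorDescent d η ρ₁ ρ) (hX : G.IsPlay d ρ s₀ μ X) (hd : 1 ≤ d)
  {h : GamePath S A} {b ℓ : ℕ} (hℓ : 1 ≤ ℓ) (hb : batchTime d h ℓ = b)

include hρ₁ hρ₁0 hρ

omit [Nonempty (Fin n)] in
theorem IsKLMirrorDescent.stepProb_nonneg (hℓ : 1 ≤ ℓ) (w w' : (∀ i, S i) × (∀ i, A i)) :
    0 ≤ G.stepProb (ρ ℓ h) w w' := by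
  refine mul_nonneg (Finset.prod_nonneg fun i _ => (G.P_mem i _ _).1 _)
    (Finset.prod_nonneg fun i _ => ?_)
  have : Nonempty (A i) := ⟨w.2 i⟩
  exact (occPolicy_pos (hρ.mem_pos hρ₁ hρ₁0 hℓ h i).2 _ _).le

include hX hd hℓ hb

/-- Given the history at the beginning of a batch, the players' state-action pairs are independent,
also on the event that one of them has not yet visited a given state in the sampling phase. -/
theorem IsPlay.measureReal_avoidSet (i : Fin n) (s : S i) (m : ℕ)
    (w : (∀ i, S i) × (∀ i, A i)) :
    μ.real {ω | (fun t => X t ω) ∈ avoidSet d h b i s m ∧ X (b + m + 1) ω = w} =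
      μ.real {ω | ∀ t ≤ b, X t ω = h t} *
        ∏ j, G.avoidLaw d (ρ ℓ h) (h b) i s m j (w.1 j, w.2 j) := by
  classical
  have hv : ∀ m, ∀ x ∈ avoidSet d h b i s m, ρ (batchIndex d x (b + m + 1)) x = ρ ℓ h := by
    intro m x hx
    rw [batchIndex_of_mem_avoidSet hℓ hb hx]
    exact hρ.congr hρ₁ hρ₁0 hℓ hx.1 (batchTime_of_agree hℓ hb hx.1).le
  induction m generalizing w with
  | zero =>
    have h1 := hX.measureReal_step (dependsUpTo_avoidSet (d := d) (h := h) (i := i) (s := s) 0)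
      (hv 0) (h b) w (hρ.stepProb_nonneg hρ₁ hρ₁0 hℓ _ _)
    have e1 : {ω | ((fun t => X t ω) ∈ avoidSet d h b i s 0 ∧ X (b + 0) ω = h b) ∧
        X (b + 0 + 1) ω = w} =
        {ω | (fun t => X t ω) ∈ avoidSet d h b i s 0 ∧ X (b + 0 + 1) ω = w} := by
      ext ω
      exact ⟨fun hω => ⟨hω.1.1, hω.2⟩, fun hω => ⟨⟨hω.1, hω.1.1 b le_rfl⟩, hω.2⟩⟩
    have e2 : {ω | (fun t => X t ω) ∈ avoidSet d h b i s 0 ∧ X (b + 0) ω = h b} =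
        {ω | ∀ t ≤ b, X t ω = h t} := by
      ext ω
      exact ⟨fun hω => hω.1.1, fun hω => ⟨(mem_avoidSet_zero hd).2 hω, hω b le_rfl⟩⟩
    rw [e1, e2] at h1
    rw [h1, mul_comm]
    congr 1
    simp only [stepProb, avoidLaw, pairLaw, killedLaw, Finset.prod_mul_distrib]
  | succ m ih =>
    have hm : MeasurableSet {ω | (fun t => X t ω) ∈ avoidSet d h b i s (m + 1) ∧
        X (b + (m + 1) + 1) ω = w} :=
      ((dependsUpTo_avoidSet (m + 1)).measurableSet hX.1).inter (hX.1 _ w)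
    rw [measureReal_eq_sum_fibers hm (hX.1 (b + (m + 1))), ← sum_stepProb_mul_avoidLaw,
      Finset.mul_sum]
    refine Finset.sum_congr rfl fun w₀ _ => ?_
    have h1 := hX.measureReal_step (dependsUpTo_avoidSet (d := d) (h := h) (i := i) (s := s)
      (m + 1)) (hv (m + 1)) w₀ w (hρ.stepProb_nonneg hρ₁ hρ₁0 hℓ _ _)
    have e1 : {ω | ω ∈ {ω | (fun t => X t ω) ∈ avoidSet d h b i s (m + 1) ∧
        X (b + (m + 1) + 1) ω = w} ∧ X (b + (m + 1)) ω = w₀} =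
        {ω | ((fun t => X t ω) ∈ avoidSet d h b i s (m + 1) ∧ X (b + (m + 1)) ω = w₀) ∧
          X (b + (m + 1) + 1) ω = w} := by
      ext ω
      exact ⟨fun hω => ⟨⟨hω.1.1, hω.2⟩, hω.1.2⟩, fun hω => ⟨⟨hω.1.1, hω.2⟩, hω.1.2⟩⟩
    rw [e1, h1, mul_left_comm]
    congr 1
    split_ifs with hw
    · have : {ω | (fun t => X t ω) ∈ avoidSet d h b i s (m + 1) ∧ X (b + (m + 1)) ω = w₀} = ∅ := by
        refine Set.eq_empty_iff_forall_notMem.2 fun ω hω => ?_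
        refine (mem_avoidSet_succ.1 hω.1).2 ⟨hw.1, ?_⟩
        have h2 : X (b + m + 1) ω = w₀ := hω.2
        simp only [h2, hw.2]
      rw [this]; simp
    · rw [← ih]
      congr 1
      ext ω
      constructor
      · exact fun hω => ⟨(mem_avoidSet_succ.1 hω.1).1, hω.2⟩
      · rintro ⟨h1, h2⟩
        exact ⟨mem_avoidSet_succ.2 ⟨h1, by simp only [h2]; exact hw⟩, h2⟩

open Classical in
/-- The law of the first sample, as a sum over the time of the first visit. -/
theorem IsPlay.hasSum_firstSample (i : Fin n) (s : S i) (w : (∀ i, S i) × (∀ i, A i)) :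
    HasSum (fun m => if w.1 i = s then μ.real {ω | ∀ t ≤ b, X t ω = h t} *
        ∏ j, G.avoidLaw d (ρ ℓ h) (h b) i s (d - 1 + m) j (w.1 j, w.2 j) else 0)
      (μ.real {ω | (∀ t ≤ b, X t ω = h t) ∧ firstSample d (fun t => X t ω) ℓ i s = some w}) := by
  have hiff : ∀ ω, (∀ t ≤ b, X t ω = h t) →
      (firstSample d (fun t => X t ω) ℓ i s = some w ↔ ∃ t, b + d ≤ t ∧ X t ω = w ∧ w.1 i = s ∧
      ∀ u, b + d ≤ u → u < t → (X u ω).1 i ≠ s) := by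
    intro ω hω
    rw [firstSample_eq_some_iff, batchTime_of_agree hℓ hb hω, ENat.toNat_natCast]
  by_cases hw : w.1 i = s
  · simp only [if_pos hw, ← hX.measureReal_avoidSet hρ₁ hρ₁0 hρ hd hℓ hb]
    have e : {ω | (∀ t ≤ b, X t ω = h t) ∧ firstSample d (fun t => X t ω) ℓ i s = some w} =
        ⋃ m, {ω | (fun t => X t ω) ∈ avoidSet d h b i s (d - 1 + m) ∧
          X (b + (d - 1 + m) + 1) ω = w} := by
      ext ω
      simp only [Set.mem_iUnion]
      constructor
      · rintro ⟨h1, h2⟩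
        obtain ⟨t, ht, hxt, -, hmin⟩ := (hiff ω h1).1 h2
        refine ⟨t - (b + d), ⟨h1, fun u hu hut => hmin u hu (by omega)⟩, ?_⟩
        rw [show b + (d - 1 + (t - (b + d))) + 1 = t by omega, hxt]
      · rintro ⟨m, ⟨h1, h2⟩, h3⟩
        exact ⟨h1, (hiff ω h1).2 ⟨_, by omega, h3, hw, fun u hu hut => h2 u hu (by omega)⟩⟩
    rw [e]
    refine hasSum_measureReal_iUnion ?_ fun m =>
      ((dependsUpTo_avoidSet _).measurableSet hX.1).inter (hX.1 _ w)
    intro m m' hne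
    refine Set.disjoint_left.2 ?_
    rintro ω ⟨⟨-, h2⟩, h3⟩ ⟨⟨-, h2'⟩, h3'⟩
    rcases lt_or_gt_of_ne hne with hlt | hlt
    · exact h2' (b + (d - 1 + m) + 1) (by omega) (by omega) (by simp only [h3]; exact hw)
    · exact h2 (b + (d - 1 + m') + 1) (by omega) (by omega) (by simp only [h3']; exact hw)
  · simp only [if_neg hw]
    have : {ω | (∀ t ≤ b, X t ω = h t) ∧ firstSample d (fun t => X t ω) ℓ i s = some w} = ∅ := by
      refine Set.eq_empty_iff_forall_notMem.2 ?_
      rintro ω ⟨h1, h2⟩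
      obtain ⟨t, -, -, hs, -⟩ := (hiff ω h1).1 h2
      exact hw hs
    rw [this]
    simp

end StochasticGame

/-! ### The first samples of a batch -/

namespace StochasticGame

variable {n : ℕ} {S A : Fin n → Type*}

theorem measurableSet_firstSample [∀ i, Fintype (S i)] [∀ i, Fintype (A i)] [Nonempty (Fin n)]
    {d : ℕ} {Ω : Type*} [MeasurableSpace Ω] {X : ℕ → Ω → (∀ i, S i) × (∀ i, A i)}
    (hX : ∀ t z, MeasurableSet {ω | X t ω = z}) {h : GamePath S A} {b ℓ : ℕ} (hℓ : 1 ≤ ℓ)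
    (hb : batchTime d h ℓ = b) (i : Fin n) (s : S i) (w : (∀ i, S i) × (∀ i, A i)) :
    MeasurableSet
      {ω | (∀ t ≤ b, X t ω = h t) ∧ firstSample d (fun t => X t ω) ℓ i s = some w} := by
  have e : {ω | (∀ t ≤ b, X t ω = h t) ∧ firstSample d (fun t => X t ω) ℓ i s = some w} =
      ⋃ t : ℕ, {ω | (fun t => X t ω) ∈ {x : GamePath S A | (∀ t ≤ b, x t = h t) ∧ b + d ≤ t ∧
        x t = w ∧ w.1 i = s ∧ ∀ u, b + d ≤ u → u < t → (x u).1 i ≠ s}} := by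
    ext ω
    simp only [Set.mem_iUnion, Set.mem_ofPred_eq, exists_and_left]
    refine and_congr_right fun hω => ?_
    rw [firstSample_eq_some_iff, batchTime_of_agree hℓ hb hω, ENat.toNat_natCast]
  rw [e]
  refine MeasurableSet.iUnion fun t => DependsUpTo.measurableSet hX (T := b + t) ?_
  rintro x y hxy ⟨h1, h2, h3, h4, h5⟩
  refine ⟨fun t ht => ?_, h2, ?_, h4, fun u hu hut => ?_⟩
  · rw [← hxy t (by omega), h1 t ht]
  · rw [← hxy t (by omega), h3]
  · rw [← hxy u (by omega)]; exact h5 u hu hut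

variable [∀ i, Fintype (S i)] [∀ i, Fintype (A i)] {G : StochasticGame S A} {d : ℕ}

theorem avoidLaw_self (v : OccProfile S A) (z : (∀ i, S i) × (∀ i, A i)) (i : Fin n) (s : S i)
    (m : ℕ) : G.avoidLaw d v z i s m i = pairLaw (killedLaw (G.inducedChain i (occPolicy (v i)))
      {s} d (G.P i (z.1 i) (z.2 i)) m) (occPolicy (v i)) := by
  simp [avoidLaw]

theorem avoidLaw_of_ne (v : OccProfile S A) (z : (∀ i, S i) × (∀ i, A i)) {i j : Fin n}
    (hj : j ≠ i) (s : S i) (m : ℕ) :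
    G.avoidLaw d v z i s m j = pairLaw (killedLaw (G.inducedChain j (occPolicy (v j)))
      ∅ d (G.P j (z.1 j) (z.2 j)) m) (occPolicy (v j)) := by
  simp [avoidLaw, hj]

section Laws

variable {v : OccProfile S A} (hv : ∀ j, v j ∈ G.occPolytope j) (hv0 : ∀ j z, 0 < v j z)
  (z : (∀ i, S i) × (∀ i, A i))
include hv0

theorem sum_avoidLaw_self (i : Fin n) (s : S i) (m : ℕ) :
    ∑ c, G.avoidLaw d v z i s m i c = ∑ s', killedLaw (G.inducedChain i (occPolicy (v i)))
      {s} d (G.P i (z.1 i) (z.2 i)) m s' := by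
  have : Nonempty (A i) := ⟨z.2 i⟩
  rw [avoidLaw_self, sum_pairLaw (occPolicy_mem (hv0 i))]

theorem avoidLaw_mem_of_ne {i j : Fin n} (hj : j ≠ i) (s : S i) (m : ℕ) :
    G.avoidLaw d v z i s m j ∈ stdSimplex ℝ (S j × A j) := by
  have : Nonempty (A j) := ⟨z.2 j⟩
  rw [avoidLaw_of_ne v z hj]
  exact pairLaw_mem (occPolicy_mem (hv0 j)) (killedLaw_empty_mem
    (inducedChain_mem (occPolicy_mem (hv0 j))) (G.P_mem j _ _) m)

theorem update_avoidLaw_mem (i : Fin n) (s : S i) (m : ℕ) (c : S i × A i) (j : Fin n) :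
    Function.update (G.avoidLaw d v z i s m) i (Set.indicator {c} 1) j ∈
      stdSimplex ℝ (S j × A j) := by
  by_cases hj : j = i
  · subst hj
    rw [Function.update_self]; exact indicator_mem_stdSimplex c
  · rw [Function.update_of_ne hj]; exact avoidLaw_mem_of_ne hv0 z hj s m

include hv

omit hv0 in
theorem update_mem (i : Fin n) (c : S i × A i) (j : Fin n) :
    Function.update v i (Set.indicator {c} 1) j ∈ stdSimplex ℝ (S j × A j) := by
  by_cases hj : j = i
  · subst hj
    rw [Function.update_self]; exact indicator_mem_stdSimplex c
  · rw [Function.update_of_ne hj]; exact G.occPolytope_subset j (hv j)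

variable {τ : ℝ} (hτ : 0 < τ) (hmix : G.MixingTimeLE τ) (hd : 1 ≤ d)
include hmix hτ hd

/-- In the sampling phase the other players are close to stationarity. Only `d - 1` steps of the
batch follow its policies, because the transition out of the first time of the batch still uses an
action of the previous one; the comparison of arbitrary transitions supplies the missing factor. -/
theorem sum_abs_avoidLaw_sub_le {i j : Fin n} (hj : j ≠ i) (s : S i) (m : ℕ) :
    ∑ c, |G.avoidLaw d v z i s (d - 1 + m) j c - v j c| ≤
      Fintype.card (A j) * Fintype.card (S j) * Real.exp (-1 / τ) ^ d := by
  have : Nonempty (A j) := ⟨z.2 j⟩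
  set κ := Real.exp (-1 / τ) with hκ
  have hκ0 : 0 ≤ κ := (Real.exp_pos _).le
  have hκ1 : κ ≤ 1 := Real.exp_le_one_iff.2 (div_nonpos_of_nonpos_of_nonneg (by norm_num) hτ.le)
  have hπ := occPolicy_mem (hv0 j)
  have e : v j = pairLaw (occMarginal (v j)) (occPolicy (v j)) := by
    ext ⟨s', a⟩; exact (occMarginal_mul_occPolicy (hv0 j) s' a).symm
  have e2 : ∑ c, |G.avoidLaw d v z i s (d - 1 + m) j c - v j c| =
      ∑ s', |killedLaw (G.inducedChain j (occPolicy (v j)))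
        ∅ d (G.P j (z.1 j) (z.2 j)) (d - 1 + m) s' - occMarginal (v j) s'| := by
    rw [avoidLaw_of_ne v z hj, ← sum_abs_pairLaw_sub hπ, ← e]
  rw [e2]
  refine (sum_abs_killedLaw_empty_sub_le (inducedChain_mem hπ) (G.P_mem j _ _) hκ0 (hmix j _ hπ)
    (occMarginal_mem (hv j)) (sum_occMarginal_mul_inducedChain (hv j) (hv0 j)) _).trans ?_
  have h1 := hmix.sum_abs_transition_sub_occMarginal_le (hv j) (z.1 j, z.2 j)
  have h2 : κ ^ (d - 1 + m) ≤ κ ^ (d - 1) := pow_le_pow_of_le_one hκ0 hκ1 (Nat.le_add_right _ _)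
  calc _ ≤ κ ^ (d - 1) * (Fintype.card (A j) * Fintype.card (S j) * κ) :=
        mul_le_mul h2 h1 (Finset.sum_nonneg fun _ _ => abs_nonneg _) (pow_nonneg hκ0 _)
    _ = _ := by
        obtain ⟨d, rfl⟩ := Nat.exists_eq_add_of_le' hd
        rw [Nat.add_sub_cancel, pow_succ]; ring

theorem abs_prodExp_avoidLaw_sub_le (i : Fin n) (c : S i × A i) (s : S i) (m : ℕ) :
    |prodExp (Function.update (G.avoidLaw d v z i s (d - 1 + m)) i (Set.indicator {c} 1))
        (G.shiftedReward i) - G.partialPayoff i v c| ≤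
      1 / 2 * (Real.exp (-1 / τ) ^ d * ∑ j, (Fintype.card (A j) : ℝ) * Fintype.card (S j)) := by
  refine (abs_prodExp_sub_le_half (update_avoidLaw_mem hv0 z i s _ c) (update_mem hv i c)
    shiftedReward_mem).trans (mul_le_mul_of_nonneg_left ?_ (by norm_num))
  rw [Finset.mul_sum]
  refine Finset.sum_le_sum fun j _ => ?_
  by_cases hj : j = i
  · subst hj
    simp only [Function.update_self, sub_self, abs_zero, Finset.sum_const_zero]
    have := Real.exp_pos (-1 / τ)
    positivity
  · simp only [Function.update_of_ne hj]
    rw [mul_comm]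
    exact sum_abs_avoidLaw_sub_le hv hv0 z hτ hmix hd hj s m

omit hd in
theorem tendsto_sum_avoidLaw (hd : 1 ≤ d) (i : Fin n) (s : S i) :
    Tendsto (fun m => ∑ c, G.avoidLaw d v z i s m i c) atTop (nhds 0) := by
  have : Nonempty (A i) := ⟨z.2 i⟩
  simp only [sum_avoidLaw_self hv0]
  have hπ := occPolicy_mem (hv0 i)
  have hκ1 : Real.exp (-1 / τ) < 1 :=
    Real.exp_lt_one_iff.2 (div_neg_of_neg_of_pos (by norm_num) hτ)
  exact tendsto_sum_killedLaw (inducedChain_mem hπ) (G.P_mem i _ _) hκ1 (hmix i _ hπ)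
    (occMarginal_mem (hv i)) (sum_occMarginal_mul_inducedChain (hv i) (hv0 i)) hd
    (occMarginal_pos (hv0 i) s)

theorem hasSum_avoidLaw_self (i : Fin n) (c : S i × A i) :
    HasSum (fun m => G.avoidLaw d v z i c.1 (d - 1 + m) i c) (occPolicy (v i) c.1 c.2) := by
  have : Nonempty (A i) := ⟨z.2 i⟩
  have hπ := occPolicy_mem (hv0 i)
  have hκ1 : Real.exp (-1 / τ) < 1 :=
    Real.exp_lt_one_iff.2 (div_neg_of_neg_of_pos (by norm_num) hτ)
  simp only [avoidLaw_self, pairLaw]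
  simpa using (hasSum_killedLaw (inducedChain_mem hπ) (G.P_mem i _ _) hκ1 (hmix i _ hπ)
    (occMarginal_mem (hv i)) (sum_occMarginal_mul_inducedChain (hv i) (hv0 i)) hd
    (occMarginal_pos (hv0 i) c.1)).mul_right (occPolicy (v i) c.1 c.2)

omit hv hτ hmix hd in
theorem avoidLaw_self_nonneg (i : Fin n) (c : S i × A i) (s : S i) (m : ℕ) :
    0 ≤ G.avoidLaw d v z i s m i c := by
  have : Nonempty (A i) := ⟨z.2 i⟩
  rw [avoidLaw_self]
  exact mul_nonneg (killedLaw_nonneg (inducedChain_mem (occPolicy_mem (hv0 i))) (G.P_mem i _ _) _ _)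
    (occPolicy_pos (hv0 i) _ _).le

end Laws

variable [Nonempty (Fin n)] {η : ℕ → ℝ} {ρ₁ : OccProfile S A}
  {ρ : ℕ → GamePath S A → OccProfile S A} {s₀ : ∀ i, S i} {Ω : Type*} [MeasurableSpace Ω]
  {μ : Measure Ω} [IsFiniteMeasure μ] {X : ℕ → Ω → (∀ i, S i) × (∀ i, A i)}

/-- A function of the first sample, integrated over the event of a given history. -/
theorem setIntegral_firstSample (hX : ∀ t z, MeasurableSet {ω | X t ω = z}) {h : GamePath S A}
    {b ℓ : ℕ} (hℓ : 1 ≤ ℓ) (hb : batchTime d h ℓ = b) (i : Fin n) (s : S i)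
    (f : Option ((∀ i, S i) × (∀ i, A i)) → ℝ) (hf : f none = 0) :
    ∫ ω in {ω | ∀ t ≤ b, X t ω = h t}, f (firstSample d (fun t => X t ω) ℓ i s) ∂μ =
      ∑ w, f (some w) *
        μ.real {ω | (∀ t ≤ b, X t ω = h t) ∧ firstSample d (fun t => X t ω) ℓ i s = some w} := by
  classical
  have hF : MeasurableSet {ω | ∀ t ≤ b, X t ω = h t} := by
    refine DependsUpTo.measurableSet hX (T := b) (E := {x | ∀ t ≤ b, x t = h t}) ?_
    intro x y hxy hx t ht
    rw [← hxy t ht, hx t ht]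
  have hT := fun w => measurableSet_firstSample (d := d) hX hℓ hb i s w
  rw [← integral_indicator hF]
  have e : (Set.indicator {ω | ∀ t ≤ b, X t ω = h t}
      fun ω => f (firstSample d (fun t => X t ω) ℓ i s)) = fun ω => ∑ w, Set.indicator
        {ω | (∀ t ≤ b, X t ω = h t) ∧ firstSample d (fun t => X t ω) ℓ i s = some w}
        (fun _ => f (some w)) ω := by
    funext ω
    by_cases hω : ∀ t ≤ b, X t ω = h t
    · rw [Set.indicator_of_mem (by exact hω)]
      simp only [Set.indicator_apply, Set.mem_ofPred_eq, eq_true hω, true_and]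
      cases hfs : firstSample d (fun t => X t ω) ℓ i s with
      | none => simp [hf]
      | some w => simp
    · rw [Set.indicator_of_notMem (by exact hω)]
      simp [hω]
  rw [e, integral_finsetSum]
  · refine Finset.sum_congr rfl fun w _ => ?_
    rw [integral_indicator_const _ (hT w), smul_eq_mul, mul_comm]
  · intro w _
    exact (integrable_const _).indicator (hT w)

variable
  (hρ₁ : ∀ i, ρ₁ i ∈ G.occPolytope i) (hρ₁0 : ∀ i z, 0 < ρ₁ i z)
  (hρ : G.IsKLMirrorDescent d η ρ₁ ρ) (hX : G.IsPlay d ρ s₀ μ X) (hd : 1 ≤ d)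
  {h : GamePath S A} {b ℓ : ℕ} (hℓ : 1 ≤ ℓ) (hb : batchTime d h ℓ = b)
  {τ : ℝ} (hτ : 0 < τ) (hmix : G.MixingTimeLE τ)

include hρ₁ hρ₁0 hρ hX hd hℓ hb hτ hmix

/-- Given the history at its beginning, a batch ends almost surely. -/
theorem IsPlay.measure_batchTime_succ_eq_top :
    μ {ω | (∀ t ≤ b, X t ω = h t) ∧ batchTime d (fun t => X t ω) (ℓ + 1) = ⊤} = 0 := by
  have hv : ∀ j, ρ ℓ h j ∈ G.occPolytope j := fun j => (hρ.mem_pos hρ₁ hρ₁0 hℓ h j).1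
  have hv0 : ∀ j z, 0 < ρ ℓ h j z := fun j => (hρ.mem_pos hρ₁ hρ₁0 hℓ h j).2
  have hsub : {ω | (∀ t ≤ b, X t ω = h t) ∧ batchTime d (fun t => X t ω) (ℓ + 1) = ⊤} ⊆
      ⋃ z : (Σ i, S i), {ω | ∀ m, (fun t => X t ω) ∈ avoidSet d h b z.1 z.2 m} := by
    rintro ω ⟨h1, h2⟩
    obtain ⟨i, s, hs⟩ := exists_mem_avoidSet_of_batchTime_eq_top hℓ hb h1 h2
    exact Set.mem_iUnion.2 ⟨⟨i, s⟩, hs⟩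
  refine measure_mono_null hsub (measure_iUnion_null ?_)
  rintro ⟨i, s⟩
  have hmass : ∀ m, μ.real {ω | (fun t => X t ω) ∈ avoidSet d h b i s m} =
      μ.real {ω | ∀ t ≤ b, X t ω = h t} * ∑ c, G.avoidLaw d (ρ ℓ h) (h b) i s m i c := by
    intro m
    rw [measureReal_eq_sum_fibers ((dependsUpTo_avoidSet m).measurableSet hX.1)
      (hX.1 (b + m + 1))]
    have := fun w => hX.measureReal_avoidSet hρ₁ hρ₁0 hρ hd hℓ hb i s m w
    simp only [Set.mem_ofPred_eq, this, ← Finset.mul_sum]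
    congr 1
    rw [sum_pair_eq_sum_pi]
    simp only [Prod.mk.eta]
    rw [sum_prod_apply, ← Finset.mul_prod_erase _ _ (Finset.mem_univ i), Finset.prod_eq_one,
      mul_one]
    exact fun j hj => (avoidLaw_mem_of_ne hv0 _ (Finset.ne_of_mem_erase hj) s m).2
  have hlim := (tendsto_sum_avoidLaw hv hv0 (h b) hτ hmix hd i s).const_mul
    (μ.real {ω | ∀ t ≤ b, X t ω = h t})
  rw [mul_zero] at hlim
  rw [← measureReal_eq_zero_iff]
  refine le_antisymm (ge_of_tendsto' hlim fun m => ?_) measureReal_nonneg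
  rw [← hmass]
  exact measureReal_mono fun ω hω => hω m

/-- On the event of a given history the estimator is almost surely a function of the first sample,
with the policy that the history determines. -/
theorem IsPlay.setIntegral_estimator (i : Fin n) (c : S i × A i) (f : ℝ → ℝ) :
    ∫ ω in {ω | ∀ t ≤ b, X t ω = h t},
        f (G.estimator d (fun t => X t ω) ℓ i (occPolicy (ρ ℓ (fun t => X t ω) i)) c) ∂μ =
      ∫ ω in {ω | ∀ t ≤ b, X t ω = h t},
        f (G.sampleValue i (occPolicy (ρ ℓ h i)) c (firstSample d (fun t => X t ω) ℓ i c.1)) ∂μ := by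
  have hF : MeasurableSet {ω | ∀ t ≤ b, X t ω = h t} := by
    refine DependsUpTo.measurableSet hX.1 (T := b) (E := {x | ∀ t ≤ b, x t = h t}) ?_
    intro x y hxy hx t ht
    rw [← hxy t ht, hx t ht]
  refine setIntegral_congr_ae hF ?_
  have hnull := hX.measure_batchTime_succ_eq_top hρ₁ hρ₁0 hρ hd hℓ hb hτ hmix
  filter_upwards [measure_eq_zero_iff_ae_notMem.1 hnull] with ω hω hωF
  have hfin : batchTime d (fun t => X t ω) (ℓ + 1) ≠ ⊤ := fun htop => hω ⟨hωF, htop⟩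
  have hρeq : ρ ℓ (fun t => X t ω) = ρ ℓ h :=
    hρ.congr hρ₁ hρ₁0 hℓ (fun t ht => hωF t ht) (batchTime_of_agree hℓ hb hωF).le
  rw [G.estimator_eq_sampleValue hℓ hfin, hρeq]

omit hτ hmix in
/-- The integral, over the event of a given history, of a function of the first sample that
vanishes unless the sampled action is `c.2`. In each summand the first factor is the probability
that player `i` first visits `c.1` at a given time and plays `c.2` there, and the second is the
expectation over the independent state-action pairs of the other players. -/
theorem IsPlay.hasSum_setIntegral_sample (i : Fin n) (c : S i × A i)
    (f : Option ((∀ i, S i) × (∀ i, A i)) → ℝ) (hf : f none = 0)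
    (hf' : ∀ w : (∀ i, S i) × (∀ i, A i), w.2 i ≠ c.2 → f (some w) = 0) :
    HasSum (fun m => μ.real {ω | ∀ t ≤ b, X t ω = h t} *
        (G.avoidLaw d (ρ ℓ h) (h b) i c.1 (d - 1 + m) i c *
          prodExp (Function.update (G.avoidLaw d (ρ ℓ h) (h b) i c.1 (d - 1 + m)) i
            (Set.indicator {c} 1)) (fun w => f (some (fun j => (w j).1, fun j => (w j).2)))))
      (∫ ω in {ω | ∀ t ≤ b, X t ω = h t}, f (firstSample d (fun t => X t ω) ℓ i c.1) ∂μ) := by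
  classical
  rw [setIntegral_firstSample hX.1 hℓ hb i c.1 f hf]
  have hs := hasSum_sum (s := Finset.univ) fun w _ =>
    (hX.hasSum_firstSample hρ₁ hρ₁0 hρ hd hℓ hb i c.1 w).mul_left (f (some w))
  refine hs.congr_fun ?_
  intro m
  rw [← sum_ite_prod_mul (G.avoidLaw d (ρ ℓ h) (h b) i c.1 (d - 1 + m)) i c, Finset.mul_sum, sum_pair_eq_sum_pi]
  refine Finset.sum_congr rfl fun w _ => ?_
  simp only [Prod.mk.eta]
  by_cases hw : w i = c
  · rw [if_pos hw, if_pos (by rw [hw])]; ring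
  · rw [if_neg hw]
    by_cases h1 : (w i).1 = c.1
    · rw [hf' _ (fun h2 => hw (Prod.ext h1 h2))]; simp
    · rw [if_neg h1]; simp

end StochasticGame

/-! ### Moments of the estimators, and the decomposition over histories -/

namespace StochasticGame

variable {n : ℕ} {S A : Fin n → Type*} [∀ i, Fintype (S i)] [∀ i, Fintype (A i)]
  {G : StochasticGame S A} {d : ℕ} {η : ℕ → ℝ} {ρ₁ : OccProfile S A}
  {ρ : ℕ → GamePath S A → OccProfile S A} {s₀ : ∀ i, S i} {Ω : Type*} [MeasurableSpace Ω]
  {μ : Measure Ω} {X : ℕ → Ω → (∀ i, S i) × (∀ i, A i)}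

section Moments

variable [Nonempty (Fin n)] [IsFiniteMeasure μ]
  (hρ₁ : ∀ i, ρ₁ i ∈ G.occPolytope i) (hρ₁0 : ∀ i z, 0 < ρ₁ i z)
  (hρ : G.IsKLMirrorDescent d η ρ₁ ρ) (hX : G.IsPlay d ρ s₀ μ X) (hd : 1 ≤ d)
  {h : GamePath S A} {b ℓ : ℕ} (hℓ : 1 ≤ ℓ) (hb : batchTime d h ℓ = b)
  {τ : ℝ} (hτ : 0 < τ) (hmix : G.MixingTimeLE τ)
include hρ₁ hρ₁0 hρ hX hd hℓ hb hτ hmix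

/-- Given the history, the estimator has small bias as an estimate of the payoff gradient. -/
theorem IsPlay.abs_setIntegral_estimator_sub_le (i : Fin n) (c : S i × A i) :
    |∫ ω in {ω | ∀ t ≤ b, X t ω = h t},
        G.estimator d (fun t => X t ω) ℓ i (occPolicy (ρ ℓ (fun t => X t ω) i)) c ∂μ -
      μ.real {ω | ∀ t ≤ b, X t ω = h t} * G.partialPayoff i (ρ ℓ h) c| ≤
    μ.real {ω | ∀ t ≤ b, X t ω = h t} *
      (1 / 2 * (Real.exp (-1 / τ) ^ d * ∑ j, (Fintype.card (A j) : ℝ) * Fintype.card (S j))) := by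
  have hv : ∀ j, ρ ℓ h j ∈ G.occPolytope j := fun j => (hρ.mem_pos hρ₁ hρ₁0 hℓ h j).1
  have hv0 : ∀ j z, 0 < ρ ℓ h j z := fun j => (hρ.mem_pos hρ₁ hρ₁0 hℓ h j).2
  have : Nonempty (A i) := ⟨c.2⟩
  have hπ : 0 < occPolicy (ρ ℓ h i) c.1 c.2 := occPolicy_pos (hv0 i) _ _
  set π := occPolicy (ρ ℓ h i) c.1 c.2 with hπdef
  set M := μ.real {ω | ∀ t ≤ b, X t ω = h t} with hM
  have hM0 : 0 ≤ M := measureReal_nonneg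
  set β := 1 / 2 * (Real.exp (-1 / τ) ^ d * ∑ j, (Fintype.card (A j) : ℝ) * Fintype.card (S j))
  rw [hX.setIntegral_estimator hρ₁ hρ₁0 hρ hd hℓ hb hτ hmix i c (fun r => r)]
  have h1 := hX.hasSum_setIntegral_sample hρ₁ hρ₁0 hρ hd hℓ hb i c
    (G.sampleValue i (occPolicy (ρ ℓ h i)) c) rfl (fun w hw => if_neg hw)
  have h2 := hasSum_avoidLaw_self hv hv0 (h b) hτ hmix hd i c
  rw [← hπdef] at h2
  set a : ℕ → ℝ := fun m => G.avoidLaw d (ρ ℓ h) (h b) i c.1 (d - 1 + m) i c with ha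
  have ha0 : ∀ m, 0 ≤ a m := fun m => avoidLaw_self_nonneg hv0 (h b) i c c.1 _
  set E : ℕ → ℝ := fun m => prodExp (Function.update
    (G.avoidLaw d (ρ ℓ h) (h b) i c.1 (d - 1 + m)) i (Set.indicator {c} 1)) (G.shiftedReward i)
  have hE : ∀ m, |E m - G.partialPayoff i (ρ ℓ h) c| ≤ β := fun m =>
    abs_prodExp_avoidLaw_sub_le hv hv0 (h b) hτ hmix hd i c c.1 m
  have h3 : ∀ m, prodExp (Function.update (G.avoidLaw d (ρ ℓ h) (h b) i c.1 (d - 1 + m)) i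
      (Set.indicator {c} 1)) (fun w => G.sampleValue i (occPolicy (ρ ℓ h i)) c
        (some (fun j => (w j).1, fun j => (w j).2))) = E m / π := by
    intro m
    have : ∀ w : ∀ j, S j × A j, w i = c → G.sampleValue i (occPolicy (ρ ℓ h i)) c
        (some (fun j => (w j).1, fun j => (w j).2)) = G.shiftedReward i w / π := by
      intro w hw
      rw [sampleValue, if_pos (by simp only [hw]), shiftedReward]
    rw [prodExp_update_indicator_congr _ _ _ this]
    simp only [E, prodExp, Finset.sum_div, mul_div_assoc]
  simp only [h3] at h1
  have hU := (h2.mul_left (M * (G.partialPayoff i (ρ ℓ h) c / π)))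
  have hβ := (h2.mul_left (M * (β / π)))
  have e1 : M * (G.partialPayoff i (ρ ℓ h) c / π) * π = M * G.partialPayoff i (ρ ℓ h) c := by
    field_simp
  have e2 : M * (β / π) * π = M * β := by field_simp
  rw [e1] at hU
  rw [e2] at hβ
  have hsub := h1.sub hU
  have hterm : ∀ m, M * (a m * (E m / π)) - M * (G.partialPayoff i (ρ ℓ h) c / π) * a m =
      M * a m / π * (E m - G.partialPayoff i (ρ ℓ h) c) := fun m => by ring
  have hterm2 : ∀ m, M * (β / π) * a m = M * a m / π * β := fun m => by ring
  have hnn : ∀ m, 0 ≤ M * a m / π := fun m => div_nonneg (mul_nonneg hM0 (ha0 m)) hπ.le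
  rw [abs_le]
  constructor
  · refine hasSum_le (fun m => ?_) hβ.neg hsub
    rw [hterm, hterm2, ← mul_neg]
    exact mul_le_mul_of_nonneg_left (abs_le.1 (hE m)).1 (hnn m)
  · refine hasSum_le (fun m => ?_) hsub hβ
    rw [hterm, hterm2]
    exact mul_le_mul_of_nonneg_left (abs_le.1 (hE m)).2 (hnn m)

/-- Given the history, the importance-weighted estimator has second moment at most `1 / π`. -/
theorem IsPlay.setIntegral_estimator_sq_le (i : Fin n) (c : S i × A i) :
    ∫ ω in {ω | ∀ t ≤ b, X t ω = h t},
        G.estimator d (fun t => X t ω) ℓ i (occPolicy (ρ ℓ (fun t => X t ω) i)) c ^ 2 ∂μ ≤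
      μ.real {ω | ∀ t ≤ b, X t ω = h t} / occPolicy (ρ ℓ h i) c.1 c.2 := by
  have hv : ∀ j, ρ ℓ h j ∈ G.occPolytope j := fun j => (hρ.mem_pos hρ₁ hρ₁0 hℓ h j).1
  have hv0 : ∀ j z, 0 < ρ ℓ h j z := fun j => (hρ.mem_pos hρ₁ hρ₁0 hℓ h j).2
  have : Nonempty (A i) := ⟨c.2⟩
  have hπ : 0 < occPolicy (ρ ℓ h i) c.1 c.2 := occPolicy_pos (hv0 i) _ _
  set π := occPolicy (ρ ℓ h i) c.1 c.2 with hπdef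
  set M := μ.real {ω | ∀ t ≤ b, X t ω = h t} with hM
  have hM0 : 0 ≤ M := measureReal_nonneg
  rw [hX.setIntegral_estimator hρ₁ hρ₁0 hρ hd hℓ hb hτ hmix i c (fun r => r ^ 2)]
  have h1 := hX.hasSum_setIntegral_sample hρ₁ hρ₁0 hρ hd hℓ hb i c
    (fun o => G.sampleValue i (occPolicy (ρ ℓ h i)) c o ^ 2) (by simp [sampleValue])
    (fun w hw => by simp [sampleValue, hw])
  have h2 := (hasSum_avoidLaw_self hv hv0 (h b) hτ hmix hd i c).mul_left (M * (1 / π ^ 2))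
  rw [← hπdef, show M * (1 / π ^ 2) * π = M / π by field_simp] at h2
  refine hasSum_le (fun m => ?_) h1 h2
  rw [mul_assoc, mul_comm (1 / π ^ 2)]
  refine mul_le_mul_of_nonneg_left (mul_le_mul_of_nonneg_left ?_
    (avoidLaw_self_nonneg hv0 (h b) i c c.1 _)) hM0
  refine prodExp_le (update_avoidLaw_mem hv0 (h b) i c.1 _ c) fun w => ?_
  rw [sampleValue, ← hπdef]
  split_ifs
  · rw [div_pow]
    refine div_le_div_of_nonneg_right ?_ (by positivity)
    have := shiftedReward_mem (G := G) (i := i) w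
    simp only [shiftedReward] at this
    nlinarith [this.1, this.2]
  · simp; positivity

end Moments

section Histories

/-- The finite trajectories at whose last time batch `ℓ` begins. -/
abbrev BatchHistory (S A : Fin n → Type*) (d ℓ : ℕ) : Type _ :=
  {p : Σ b : ℕ, (Fin (b + 1) → (∀ i, S i) × (∀ i, A i)) //
    batchTime d (extendPath p.2) ℓ = (p.1 : ℕ∞)}

/-- The event that the play begins with the history `p`. -/
def historySet (X : ℕ → Ω → (∀ i, S i) × (∀ i, A i)) {d ℓ : ℕ} (p : BatchHistory S A d ℓ) :
    Set Ω :=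
  {ω | ∀ t ≤ p.1.1, X t ω = extendPath p.1.2 t}

omit [MeasurableSpace Ω] [∀ i, Fintype (S i)] [∀ i, Fintype (A i)] in
theorem pairwise_disjoint_historySet [Nonempty (Fin n)] {ℓ : ℕ} (hℓ : 1 ≤ ℓ) :
    Pairwise (Function.onFun Disjoint (historySet (S := S) (A := A) (d := d) (ℓ := ℓ) X)) := by
  rintro ⟨⟨b, p⟩, hp⟩ ⟨⟨b', p'⟩, hp'⟩ hne
  refine Set.disjoint_left.2 fun ω h1 h2 => hne ?_
  have e : (b : ℕ∞) = b' :=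
    (batchTime_of_agree (x := fun t => X t ω) hℓ hp h1).symm.trans
      (batchTime_of_agree (x := fun t => X t ω) hℓ hp' h2)
  obtain rfl : b = b' := by exact_mod_cast e
  have : p = p' := by
    funext t
    have h3 := (h1 t (by simp only []; omega)).symm.trans (h2 t (by simp only []; omega))
    rwa [extendPath_apply p (by omega), extendPath_apply p' (by omega)] at h3
  subst this
  rfl

theorem measurableSet_historySet (hX : ∀ t z, MeasurableSet {ω | X t ω = z}) {ℓ : ℕ}
    (p : BatchHistory S A d ℓ) : MeasurableSet (historySet X p) := by
  refine DependsUpTo.measurableSet hX (T := p.1.1)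
    (E := {x | ∀ t ≤ p.1.1, x t = extendPath p.1.2 t}) ?_
  intro x y hxy hx t ht
  rw [← hxy t ht, hx t ht]

omit [MeasurableSpace Ω] [∀ i, Fintype (S i)] [∀ i, Fintype (A i)] in
theorem exists_mem_historySet [Nonempty (Fin n)] {ℓ : ℕ} (hℓ : 1 ≤ ℓ) {ω : Ω}
    (hω : batchTime d (fun t => X t ω) ℓ ≠ ⊤) :
    ∃ p : BatchHistory S A d ℓ, ω ∈ historySet X p := by
  obtain ⟨b, hb⟩ := ENat.ne_top_iff_exists.1 hω
  have h1 : ∀ t ≤ b, X t ω = extendPath (fun t : Fin (b + 1) => X t ω) t :=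
    extendPath_restrict (fun t => X t ω) rfl
  refine ⟨⟨⟨b, fun t => X t ω⟩, ?_⟩, h1⟩
  simp only []
  rw [hb]
  exact batchTime_congr h1 hℓ hb.ge

omit [∀ i, Fintype (S i)] [∀ i, Fintype (A i)] in
theorem iUnion_historySet_ae_eq_univ [Nonempty (Fin n)] {ℓ : ℕ} (hℓ : 1 ≤ ℓ)
    (hfin : ∀ᵐ ω ∂μ, batchTime d (fun t => X t ω) ℓ ≠ ⊤) :
    (⋃ p : BatchHistory S A d ℓ, historySet X p) =ᵐ[μ] Set.univ := by
  rw [ae_eq_univ]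
  refine measure_mono_null ?_ (ae_iff.1 hfin)
  intro ω hω
  simp only [Set.mem_compl_iff, Set.mem_iUnion, not_exists] at hω
  intro hne
  obtain ⟨p, hp⟩ := exists_mem_historySet hℓ hne
  exact hω p hp

/-- A function of the trajectory that is determined by the history up to `τ^ℓ` is constant on each
of countably many events that cover the space up to a null set. -/
theorem aestronglyMeasurable_of_adapted [Nonempty (Fin n)]
    (hX : ∀ t z, MeasurableSet {ω | X t ω = z}) {ℓ : ℕ} (hℓ : 1 ≤ ℓ)
    (hfin : ∀ᵐ ω ∂μ, batchTime d (fun t => X t ω) ℓ ≠ ⊤) {g : GamePath S A → ℝ}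
    (hg : ∀ x y : GamePath S A, ∀ m : ℕ, (∀ t ≤ m, x t = y t) → batchTime d x ℓ ≤ m → g x = g y) :
    AEStronglyMeasurable (fun ω => g fun t => X t ω) μ := by
  have hU := iUnion_historySet_ae_eq_univ hℓ hfin
  rw [← Measure.restrict_univ (μ := μ), ← Measure.restrict_congr_set hU,
    aestronglyMeasurable_iUnion_iff]
  intro p
  refine (aestronglyMeasurable_const (b := g (extendPath p.1.2))).congr ?_
  filter_upwards [ae_restrict_mem (measurableSet_historySet hX p)] with ω hω
  exact hg _ _ p.1.1 (fun t ht => (hω t ht).symm) p.2.le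

/-- A bound on the integrals over all histories of a batch bounds the expectation. -/
theorem integral_le_of_historySet [Nonempty (Fin n)] [IsProbabilityMeasure μ]
    (hX : ∀ t z, MeasurableSet {ω | X t ω = z}) {ℓ : ℕ} (hℓ : 1 ≤ ℓ)
    (hfin : ∀ᵐ ω ∂μ, batchTime d (fun t => X t ω) ℓ ≠ ⊤) {f : Ω → ℝ} (hf : Integrable f μ) {C : ℝ}
    (hC : ∀ p : BatchHistory S A d ℓ,
      ∫ ω in historySet X p, f ω ∂μ ≤ μ.real (historySet X p) * C) :
    ∫ ω, f ω ∂μ ≤ C := by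
  have hU := iUnion_historySet_ae_eq_univ hℓ hfin
  have hm := fun p : BatchHistory S A d ℓ => measurableSet_historySet hX p
  have h1 := hasSum_integral_iUnion hm (pairwise_disjoint_historySet (X := X) hℓ)
    (hf.integrableOn (s := ⋃ p, historySet X p))
  have h2 := (hasSum_measureReal_iUnion (μ := μ) (pairwise_disjoint_historySet (X := X) hℓ)
    hm).mul_right C
  rw [setIntegral_congr_set hU, setIntegral_univ] at h1
  rw [measureReal_congr hU, probReal_univ, one_mul] at h2
  exact hasSum_le hC h1 h2

end Histories

section Iterates

variable [Nonempty (Fin n)]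
  (hρ₁ : ∀ i, ρ₁ i ∈ G.occPolytope i) (hρ₁0 : ∀ i z, 0 < ρ₁ i z)
  (hρ : G.IsKLMirrorDescent d η ρ₁ ρ) (hd : 1 ≤ d)

/-- The occupation measures of batch `ℓ` together with the estimators formed in it. -/
noncomputable def iterateEstimate (G : StochasticGame S A) (d : ℕ)
    (ρ : ℕ → GamePath S A → OccProfile S A) (ℓ : ℕ) (x : GamePath S A) :
    OccProfile S A × OccProfile S A :=
  (ρ ℓ x, fun i c => G.estimator d x ℓ i (occPolicy (ρ ℓ x i)) c)

include hρ₁ hρ₁0 hρ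

theorem iterateEstimate_congr {ℓ : ℕ} (hℓ : 1 ≤ ℓ) {x y : GamePath S A} {m : ℕ}
    (hxy : ∀ t ≤ m, x t = y t) (hm : batchTime d x (ℓ + 1) ≤ m) :
    iterateEstimate G d ρ ℓ x = iterateEstimate G d ρ ℓ y := by
  have h1 : ρ ℓ x = ρ ℓ y :=
    hρ.congr hρ₁ hρ₁0 hℓ hxy ((batchTime_mono hℓ (Nat.le_succ ℓ)).trans hm)
  simp only [iterateEstimate, h1, Prod.mk.injEq, true_and]
  funext i c
  exact (G.estimator_congr hxy hℓ hm i _ c).symm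

include hd in
theorem finite_range_iterateEstimate {ℓ : ℕ} (hℓ : 1 ≤ ℓ) :
    (Set.range (iterateEstimate G d ρ ℓ)).Finite := by
  classical
  have := (hρ.finite_range hρ₁ hρ₁0 hd hℓ).to_subtype
  let f : Set.range (ρ ℓ) × Option (∀ i, S i → Option ((∀ i, S i) × (∀ i, A i))) →
      OccProfile S A × OccProfile S A := fun q => (q.1.1, fun i c => match q.2 with
        | none => 0
        | some o => G.sampleValue i (occPolicy (q.1.1 i)) c (o i c.1))
  refine (Set.finite_range f).subset ?_
  rintro _ ⟨x, rfl⟩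
  by_cases ht : batchTime d x (ℓ + 1) = ⊤
  · refine ⟨(⟨ρ ℓ x, x, rfl⟩, none), ?_⟩
    simp only [f, iterateEstimate, Prod.mk.injEq, true_and]
    funext i c
    exact (G.estimator_of_eq_top hd ht i _ c).symm
  · refine ⟨(⟨ρ ℓ x, x, rfl⟩, some fun i s => firstSample d x ℓ i s), ?_⟩
    simp only [f, iterateEstimate, Prod.mk.injEq, true_and]
    funext i c
    exact (G.estimator_eq_sampleValue hℓ ht i _ c).symm

variable [IsFiniteMeasure μ] (hX : G.IsPlay d ρ s₀ μ X) {τ : ℝ} (hτ : 0 < τ)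
  (hmix : G.MixingTimeLE τ)
include hd hX hτ hmix

theorem IsPlay.ae_batchTime_ne_top {ℓ : ℕ} (hℓ : 1 ≤ ℓ) :
    ∀ᵐ ω ∂μ, batchTime d (fun t => X t ω) ℓ ≠ ⊤ := by
  induction ℓ, hℓ using Nat.le_induction with
  | base => exact Eventually.of_forall fun ω => by simp [batchTime]
  | succ ℓ hℓ ih =>
    have h1 : ∀ᵐ ω ∂μ, ∀ p : BatchHistory S A d ℓ, ω ∉ {ω | (∀ t ≤ p.1.1,
        X t ω = extendPath p.1.2 t) ∧ batchTime d (fun t => X t ω) (ℓ + 1) = ⊤} :=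
      ae_all_iff.2 fun p => measure_eq_zero_iff_ae_notMem.1
        (hX.measure_batchTime_succ_eq_top hρ₁ hρ₁0 hρ hd hℓ p.2 hτ hmix)
    filter_upwards [ih, h1] with ω hω h1 htop
    obtain ⟨p, hp⟩ := exists_mem_historySet hℓ hω
    exact h1 p ⟨hp, htop⟩

/-- Every function of an iterate and its estimators is integrable along the play: it takes
finitely many values, and almost surely a finite history determines it. -/
theorem IsPlay.integrable_iterateEstimate {ℓ : ℕ} (hℓ : 1 ≤ ℓ)
    (g : OccProfile S A × OccProfile S A → ℝ) :
    Integrable (fun ω => g (iterateEstimate G d ρ ℓ fun t => X t ω)) μ := by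
  have hmeas : AEStronglyMeasurable (fun ω => g (iterateEstimate G d ρ ℓ fun t => X t ω)) μ :=
    aestronglyMeasurable_of_adapted (g := fun x => g (iterateEstimate G d ρ ℓ x)) hX.1
      (Nat.le_succ_of_le hℓ)
      (hX.ae_batchTime_ne_top hρ₁ hρ₁0 hρ hd hτ hmix (Nat.le_succ_of_le hℓ))
      fun x y m hxy hm => by rw [iterateEstimate_congr hρ₁ hρ₁0 hρ hℓ hxy hm]
  have hfin : (Set.range fun x => ‖g (iterateEstimate G d ρ ℓ x)‖).Finite := by
    have := (finite_range_iterateEstimate hρ₁ hρ₁0 hρ hd hℓ).image fun q => ‖g q‖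
    rwa [← Set.range_comp] at this
  obtain ⟨C, hC⟩ := hfin.bddAbove
  exact Integrable.of_bound hmeas C (Eventually.of_forall fun ω => hC ⟨_, rfl⟩)

end Iterates

end StochasticGame

/-! ### Regret and expectation -/

namespace StochasticGame

variable {n : ℕ} {S A : Fin n → Type*} [∀ i, Fintype (S i)] [∀ i, Fintype (A i)]
  {G : StochasticGame S A} {d : ℕ} {η : ℕ → ℝ} {ρ₁ : OccProfile S A}
  {ρ : ℕ → GamePath S A → OccProfile S A}

/-- The linearized regret of a profile `θ` against the iterate `q.1`, with the estimators `q.2` in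
place of the payoff gradients. -/
def linearRegret (θ : OccProfile S A) (q : OccProfile S A × OccProfile S A) : ℝ :=
  ∑ i, ∑ c, q.2 i c * (θ i c - q.1 i c)

/-- The squared local norm of the estimators `q.2` at the iterate `q.1`. -/
def localNormSq (q : OccProfile S A × OccProfile S A) : ℝ :=
  ∑ i, ∑ c, q.1 i c * q.2 i c ^ 2

theorem estimator_nonpos {x : GamePath S A} {k : ℕ} {i : Fin n} {π : S i → A i → ℝ}
    (hπ : ∀ s a, 0 ≤ π s a) (c : S i × A i) : G.estimator d x k i π c ≤ 0 := by
  refine Finset.sum_nonpos fun t _ => ?_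
  split_ifs
  · exact div_nonpos_of_nonpos_of_nonneg (by linarith [(G.r_mem i (x t).1 (x t).2).2]) (hπ _ _)
  · exact le_rfl

section Regret

variable (hρ₁ : ∀ i, ρ₁ i ∈ G.occPolytope i) (hρ₁0 : ∀ i z, 0 < ρ₁ i z)
  (hρ : G.IsKLMirrorDescent d η ρ₁ ρ) (hη : ∀ ℓ, 1 ≤ ℓ → 0 ≤ η ℓ)
include hρ₁ hρ₁0 hρ hη

theorem IsKLMirrorDescent.step_le {ℓ : ℕ} (hℓ : 1 ≤ ℓ) (x : GamePath S A) {θ : OccProfile S A}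
    (hθ : ∀ i, θ i ∈ G.occPolytope i) :
    η ℓ * linearRegret θ (iterateEstimate G d ρ ℓ x) ≤
      ∑ i, klDivergence (θ i) (ρ ℓ x i) - ∑ i, klDivergence (θ i) (ρ (ℓ + 1) x i) +
        1 / 2 * (η ℓ ^ 2 * localNormSq (iterateEstimate G d ρ ℓ x)) := by
  simp only [linearRegret, localNormSq, iterateEstimate]
  rw [← Finset.sum_sub_distrib, Finset.mul_sum, Finset.mul_sum, Finset.mul_sum,
    ← Finset.sum_add_distrib]
  refine Finset.sum_le_sum fun i _ => ?_
  have hm := hρ.mem_pos hρ₁ hρ₁0 hℓ x i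
  have : Nonempty (A i) := (nonempty_of_mem_occPolytope hm.1).map Prod.snd
  have h := (hρ.2 ℓ hℓ x i).regret_le (G.convex_occPolytope i) (G.occPolytope_subset i)
    (hρ₁ i) (hρ₁0 i) hm.2 hm.1.2.2
    (fun c => mul_nonpos_of_nonneg_of_nonpos (hη ℓ hℓ)
      (estimator_nonpos (fun s a => (occPolicy_pos hm.2 s a).le) c)) (hθ i)
  refine (le_of_eq ?_).trans (h.trans (le_of_eq ?_))
  · rw [Finset.mul_sum]
    exact Finset.sum_congr rfl fun c _ => by ring
  · congr 2
    rw [Finset.mul_sum]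
    exact Finset.sum_congr rfl fun c _ => by ring

/-- The regret bound of mirror descent on one trajectory. -/
theorem IsKLMirrorDescent.sum_linearRegret_le (x : GamePath S A) {θ : OccProfile S A}
    (hθ : ∀ i, θ i ∈ G.occPolytope i) (k : ℕ) :
    ∑ ℓ ∈ Finset.Icc 1 k, η ℓ * linearRegret θ (iterateEstimate G d ρ ℓ x) ≤
      ∑ i, klDivergence (θ i) (ρ₁ i) +
        1 / 2 * ∑ ℓ ∈ Finset.Icc 1 k, η ℓ ^ 2 * localNormSq (iterateEstimate G d ρ ℓ x) := by
  have key : ∑ ℓ ∈ Finset.Icc 1 k, η ℓ * linearRegret θ (iterateEstimate G d ρ ℓ x) ≤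
      ∑ i, klDivergence (θ i) (ρ₁ i) - ∑ i, klDivergence (θ i) (ρ (k + 1) x i) +
        1 / 2 * ∑ ℓ ∈ Finset.Icc 1 k, η ℓ ^ 2 * localNormSq (iterateEstimate G d ρ ℓ x) := by
    induction k with
    | zero => simp [hρ.1]
    | succ k ih =>
      rw [Finset.sum_Icc_succ_top (by omega), Finset.sum_Icc_succ_top (by omega)]
      have := hρ.step_le hρ₁ hρ₁0 hη (Nat.le_add_left 1 k) x hθ
      linarith
  have hnn : 0 ≤ ∑ i, klDivergence (θ i) (ρ (k + 1) x i) :=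
    Finset.sum_nonneg fun i _ => by
      have hm := hρ.mem_pos hρ₁ hρ₁0 (Nat.le_add_left 1 k) x i
      exact klDivergence_nonneg (G.occPolytope_subset i (hθ i)) hm.2 hm.1.2.2
  linarith

end Regret

section Expectation

variable [Nonempty (Fin n)] {s₀ : ∀ i, S i} {Ω : Type*} [MeasurableSpace Ω] {μ : Measure Ω}
  [IsProbabilityMeasure μ] {X : ℕ → Ω → (∀ i, S i) × (∀ i, A i)}
  (hρ₁ : ∀ i, ρ₁ i ∈ G.occPolytope i) (hρ₁0 : ∀ i z, 0 < ρ₁ i z)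
  (hρ : G.IsKLMirrorDescent d η ρ₁ ρ) (hX : G.IsPlay d ρ s₀ μ X) (hd : 1 ≤ d)
  {τ : ℝ} (hτ : 0 < τ) (hmix : G.MixingTimeLE τ) {ℓ : ℕ} (hℓ : 1 ≤ ℓ)
include hρ₁ hρ₁0 hρ hX hd hτ hmix hℓ

theorem IsPlay.integral_localNormSq_le :
    ∫ ω, localNormSq (iterateEstimate G d ρ ℓ fun t => X t ω) ∂μ ≤
      ∑ i, (Fintype.card (A i) : ℝ) := by
  refine integral_le_of_historySet hX.1 hℓ
    (hX.ae_batchTime_ne_top hρ₁ hρ₁0 hρ hd hτ hmix hℓ)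
    (hX.integrable_iterateEstimate hρ₁ hρ₁0 hρ hd hτ hmix hℓ localNormSq) fun p => ?_
  set h : GamePath S A := extendPath p.1.2 with hh
  have hb : batchTime d h ℓ = p.1.1 := p.2
  have hm := hρ.mem_pos hρ₁ hρ₁0 hℓ h
  have e : ∫ ω in historySet X p, localNormSq (iterateEstimate G d ρ ℓ fun t => X t ω) ∂μ =
      ∫ ω in historySet X p, ∑ i, ∑ c, ρ ℓ h i c *
        (iterateEstimate G d ρ ℓ fun t => X t ω).2 i c ^ 2 ∂μ := by
    refine setIntegral_congr_fun (measurableSet_historySet hX.1 p) fun ω hω => ?_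
    have : ρ ℓ (fun t => X t ω) = ρ ℓ h :=
      hρ.congr hρ₁ hρ₁0 hℓ (fun t ht => hω t ht) (batchTime_of_agree hℓ hb hω).le
    simp only [localNormSq, iterateEstimate, this]
  have hint : ∀ i c, IntegrableOn (fun ω => ρ ℓ h i c *
      (iterateEstimate G d ρ ℓ fun t => X t ω).2 i c ^ 2) (historySet X p) μ := fun i c =>
    (hX.integrable_iterateEstimate hρ₁ hρ₁0 hρ hd hτ hmix hℓ
      fun q => ρ ℓ h i c * q.2 i c ^ 2).integrableOn
  rw [e, integral_finsetSum _ fun i _ => integrable_finsetSum _ fun c _ => hint i c,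
    Finset.mul_sum]
  refine Finset.sum_le_sum fun i _ => ?_
  have : Nonempty (A i) := (nonempty_of_mem_occPolytope (hm i).1).map Prod.snd
  rw [integral_finsetSum _ fun c _ => hint i c]
  calc ∑ c, ∫ ω in historySet X p, ρ ℓ h i c *
        (iterateEstimate G d ρ ℓ fun t => X t ω).2 i c ^ 2 ∂μ
      ≤ ∑ c : S i × A i, μ.real (historySet X p) * occMarginal (ρ ℓ h i) c.1 := by
        refine Finset.sum_le_sum fun c _ => ?_
        rw [integral_const_mul]
        have h1 := hX.setIntegral_estimator_sq_le hρ₁ hρ₁0 hρ hd hℓ hb hτ hmix i c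
        refine (mul_le_mul_of_nonneg_left h1 ((hm i).2 c).le).trans_eq ?_
        have hπ := occPolicy_pos (hm i).2 c.1 c.2
        have h2 := occMarginal_mul_occPolicy (hm i).2 c.1 c.2
        rw [← h2]
        have : historySet X p = {ω | ∀ t ≤ p.1.1, X t ω = h t} := rfl
        rw [this]
        field_simp
    _ = _ := by
        rw [← Finset.mul_sum, Fintype.sum_prod_type]
        simp only [Finset.sum_const, Finset.card_univ, nsmul_eq_mul, ← Finset.mul_sum,
          (occMarginal_mem (hm i).1).2, mul_one]

/-- In expectation the Nikaido-Isoda function exceeds the linearized regret only by the bias of the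
estimators. -/
theorem IsPlay.integral_nikaidoIsoda_sub_le {θ : OccProfile S A}
    (hθ : ∀ i, θ i ∈ G.occPolytope i) :
    ∫ ω, (G.nikaidoIsoda θ (ρ ℓ fun t => X t ω) -
        linearRegret θ (iterateEstimate G d ρ ℓ fun t => X t ω)) ∂μ ≤
      n * (Real.exp (-1 / τ) ^ d * ∑ j, (Fintype.card (A j) : ℝ) * Fintype.card (S j)) := by
  refine integral_le_of_historySet hX.1 hℓ
    (hX.ae_batchTime_ne_top hρ₁ hρ₁0 hρ hd hτ hmix hℓ)
    (hX.integrable_iterateEstimate hρ₁ hρ₁0 hρ hd hτ hmix hℓ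
      fun q => G.nikaidoIsoda θ q.1 - linearRegret θ q) fun p => ?_
  set h : GamePath S A := extendPath p.1.2 with hh
  have hb : batchTime d h ℓ = p.1.1 := p.2
  have hm := hρ.mem_pos hρ₁ hρ₁0 hℓ h
  set κ := Real.exp (-1 / τ) ^ d * ∑ j, (Fintype.card (A j) : ℝ) * Fintype.card (S j) with hκ
  have hκ0 : 0 ≤ κ := by have := Real.exp_pos (-1 / τ); positivity
  have e : ∫ ω in historySet X p, (G.nikaidoIsoda θ (ρ ℓ fun t => X t ω) -
        linearRegret θ (iterateEstimate G d ρ ℓ fun t => X t ω)) ∂μ =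
      ∫ ω in historySet X p, ∑ i, ∑ c, (θ i c - ρ ℓ h i c) * (G.partialPayoff i (ρ ℓ h) c -
        (iterateEstimate G d ρ ℓ fun t => X t ω).2 i c) ∂μ := by
    refine setIntegral_congr_fun (measurableSet_historySet hX.1 p) fun ω hω => ?_
    have : ρ ℓ (fun t => X t ω) = ρ ℓ h :=
      hρ.congr hρ₁ hρ₁0 hℓ (fun t ht => hω t ht) (batchTime_of_agree hℓ hb hω).le
    simp only [linearRegret, iterateEstimate, this]
    rw [nikaidoIsoda_eq (fun j => (hθ j).2.2) (fun j => (hm j).1.2.2), ← Finset.sum_sub_distrib]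
    refine Finset.sum_congr rfl fun i _ => ?_
    rw [← Finset.sum_sub_distrib]
    exact Finset.sum_congr rfl fun c _ => by ring
  have hest : ∀ i c, IntegrableOn (fun ω => (iterateEstimate G d ρ ℓ fun t => X t ω).2 i c)
      (historySet X p) μ := fun i c =>
    (hX.integrable_iterateEstimate hρ₁ hρ₁0 hρ hd hτ hmix hℓ fun q => q.2 i c).integrableOn
  have hint : ∀ i c, IntegrableOn (fun ω => (θ i c - ρ ℓ h i c) * (G.partialPayoff i (ρ ℓ h) c -
      (iterateEstimate G d ρ ℓ fun t => X t ω).2 i c)) (historySet X p) μ := fun i c =>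
    ((integrable_const _).sub (hest i c)).const_mul _
  have hterm : ∀ i c, ∫ ω in historySet X p, (θ i c - ρ ℓ h i c) *
      (G.partialPayoff i (ρ ℓ h) c - (iterateEstimate G d ρ ℓ fun t => X t ω).2 i c) ∂μ ≤
      (θ i c + ρ ℓ h i c) * (μ.real (historySet X p) * (1 / 2 * κ)) := by
    intro i c
    have h1 := hX.abs_setIntegral_estimator_sub_le hρ₁ hρ₁0 hρ hd hℓ hb hτ hmix i c
    rw [abs_sub_comm] at h1
    rw [integral_const_mul, integral_sub (integrable_const _) (hest i c), setIntegral_const,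
      smul_eq_mul]
    refine (le_abs_self _).trans ?_
    rw [abs_mul]
    refine mul_le_mul ?_ h1 (abs_nonneg _) (add_nonneg ((hθ i).1 c) ((hm i).2 c).le)
    rw [abs_le]; constructor <;> linarith [(hθ i).1 c, (hm i).2 c]
  refine e.trans_le ?_
  rw [integral_finsetSum _ fun i _ => integrable_finsetSum _ fun c _ => hint i c]
  calc ∑ i, ∫ ω in historySet X p, ∑ c, (θ i c - ρ ℓ h i c) * (G.partialPayoff i (ρ ℓ h) c -
        (iterateEstimate G d ρ ℓ fun t => X t ω).2 i c) ∂μ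
      ≤ ∑ i : Fin n, μ.real (historySet X p) * κ := by
        refine Finset.sum_le_sum fun i _ => ?_
        rw [integral_finsetSum _ fun c _ => hint i c]
        refine (Finset.sum_le_sum fun c _ => hterm i c).trans_eq ?_
        rw [← Finset.sum_mul, Finset.sum_add_distrib, (hθ i).2.2, (hm i).1.2.2]
        ring
    _ = _ := by
        rw [Finset.sum_const, Finset.card_univ, Fintype.card_fin, nsmul_eq_mul]
        ring

end Expectation

end StochasticGame

/-- The threshold makes the total bias at most half of the accuracy. -/
theorem bias_le_half {n d : ℕ} (hn : 0 < n) {τ ε N : ℝ} (hτ : 0 < τ) (hε : 0 < ε) (hN : 0 < N)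
    (hd : τ * Real.log (2 * n / ε * N) ≤ d) :
    n * (Real.exp (-1 / τ) ^ d * N) ≤ ε / 2 := by
  have hn' : (0 : ℝ) < n := Nat.cast_pos.2 hn
  have hC : 0 < 2 * n / ε * N := by positivity
  have h1 : Real.log (2 * n / ε * N) ≤ d / τ := by rw [le_div_iff₀ hτ]; linarith
  have h2 : 2 * n / ε * N ≤ Real.exp (d / τ) := (Real.log_le_iff_le_exp hC).1 h1
  have h3 : Real.exp (-1 / τ) ^ d * Real.exp (d / τ) = 1 := by
    rw [← Real.exp_nat_mul, ← Real.exp_add, Real.exp_eq_one_iff]; ring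
  have h4 : Real.exp (-1 / τ) ^ d * (2 * n / ε * N) ≤ 1 :=
    (mul_le_mul_of_nonneg_left h2 (pow_nonneg (Real.exp_pos _).le _)).trans_eq h3
  have h5 : n * (Real.exp (-1 / τ) ^ d * N) =
      ε / 2 * (Real.exp (-1 / τ) ^ d * (2 * n / ε * N)) := by field_simp
  rw [h5]
  calc ε / 2 * (Real.exp (-1 / τ) ^ d * (2 * n / ε * N)) ≤ ε / 2 * 1 :=
        mul_le_mul_of_nonneg_left h4 (by positivity)
    _ = ε / 2 := mul_one _

theorem mainTheorem4 {n : ℕ} {S A : Fin n → Type*} [∀ i, Fintype (S i)] [∀ i, Fintype (A i)]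
    (G : StochasticGame S A)
    -- mixing time, accuracy and threshold
    (τ : ℝ) (hτ : 0 < τ) (hmix : G.MixingTimeLE τ)
    (ε : ℝ) (hε : 0 < ε)
    (d : ℕ) (hd_pos : 1 ≤ d)
    (hd : τ * Real.log (2 * n / ε * ∑ i, (Fintype.card (A i) : ℝ) * Fintype.card (S i)) ≤ d)
    -- step sizes
    (η : ℕ → ℝ) (hη : ∀ ℓ, 1 ≤ ℓ → 0 ≤ η ℓ)
    (hη_sum : Tendsto (fun k => ∑ ℓ ∈ Finset.Icc 1 k, η ℓ) atTop atTop)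
    (hη_sq : Summable fun ℓ => η ℓ ^ 2)
    -- shrinking parameters and initial occupation measures
    (δ : Fin n → ℝ) (hδ : ∀ i, 0 < δ i)
    (ρ₁ : OccProfile S A) (hρ₁ : ∀ i, ρ₁ i ∈ G.shrunkPolytope i (δ i))
    (hρ₁_kl : ∀ i, ∀ θ ∈ G.shrunkPolytope i (δ i),
      klDivergence θ (ρ₁ i) ≤ 2 * Real.log ((Fintype.card (S i) : ℝ) * Fintype.card (A i)))
    -- the algorithm and the random play that it generates
    (ρ : ℕ → GamePath S A → OccProfile S A) (hρ : G.IsKLMirrorDescent d η ρ₁ ρ)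
    (s₀ : ∀ i, S i)
    {Ω : Type*} [MeasurableSpace Ω] (μ : Measure Ω) [IsProbabilityMeasure μ]
    (X : ℕ → Ω → (∀ i, S i) × (∀ i, A i)) (hX : G.IsPlay d ρ s₀ μ X)
    (k : ℕ)
    (hk : 1 / ε * (4 * ∑ i, Real.log ((Fintype.card (S i) : ℝ) * Fintype.card (A i))
        + (∑ i, (Fintype.card (A i) : ℝ)) * ∑ ℓ ∈ Finset.Icc 1 k, η ℓ ^ 2)
      ≤ ∑ ℓ ∈ Finset.Icc 1 k, η ℓ) :
    ∀ θ : OccProfile S A, (∀ i, θ i ∈ G.shrunkPolytope i (δ i)) →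
      Integrable (fun ω => ∑ ℓ ∈ Finset.Icc 1 k,
        η ℓ / (∑ m ∈ Finset.Icc 1 k, η m) * G.nikaidoIsoda θ (ρ ℓ fun t => X t ω)) μ ∧
      ∫ ω, ∑ ℓ ∈ Finset.Icc 1 k,
        η ℓ / (∑ m ∈ Finset.Icc 1 k, η m) * G.nikaidoIsoda θ (ρ ℓ fun t => X t ω) ∂μ ≤ ε := by
  intro θ hθ
  have hρ₁m : ∀ i, ρ₁ i ∈ G.occPolytope i := fun i => (hρ₁ i).1
  have hρ₁0 : ∀ i z, 0 < ρ₁ i z := fun i z => (hδ i).trans_le ((hρ₁ i).2 z)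
  have hθm : ∀ i, θ i ∈ G.occPolytope i := fun i => (hθ i).1
  rcases Nat.eq_zero_or_pos n with rfl | hn
  · simp only [StochasticGame.nikaidoIsoda, Finset.univ_eq_empty, Finset.sum_empty, mul_zero,
      Finset.sum_const_zero, integral_zero]
    exact ⟨integrable_zero _ _ _, hε.le⟩
  have : Nonempty (Fin n) := ⟨⟨0, hn⟩⟩
  set w := ∑ m ∈ Finset.Icc 1 k, η m with hw
  have hw0 : 0 ≤ w := Finset.sum_nonneg fun ℓ hℓ => hη ℓ (Finset.mem_Icc.1 hℓ).1
  have hint := fun ℓ (hℓ : ℓ ∈ Finset.Icc 1 k) =>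
    hX.integrable_iterateEstimate hρ₁m hρ₁0 hρ hd_pos hτ hmix (Finset.mem_Icc.1 hℓ).1
  have hΨ : ∀ ℓ ∈ Finset.Icc 1 k, Integrable (fun ω => G.nikaidoIsoda θ (ρ ℓ fun t => X t ω)) μ :=
    fun ℓ hℓ => hint ℓ hℓ fun q => G.nikaidoIsoda θ q.1
  have hD := fun ℓ hℓ => hint ℓ hℓ (StochasticGame.linearRegret θ)
  have hQ := fun ℓ hℓ => hint ℓ hℓ StochasticGame.localNormSq
  refine ⟨integrable_finsetSum _ fun ℓ hℓ => (hΨ ℓ hℓ).const_mul _, ?_⟩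
  rw [integral_finsetSum _ fun ℓ hℓ => (hΨ ℓ hℓ).const_mul _]
  simp only [integral_const_mul]
  have hN : 0 < ∑ i, (Fintype.card (A i) : ℝ) * Fintype.card (S i) :=
    Finset.sum_pos (fun i _ => by
      obtain ⟨c⟩ := StochasticGame.nonempty_of_mem_occPolytope (hρ₁m i)
      have h1 : 0 < Fintype.card (A i) := Fintype.card_pos_iff.2 ⟨c.2⟩
      have h2 : 0 < Fintype.card (S i) := Fintype.card_pos_iff.2 ⟨c.1⟩
      positivity) Finset.univ_nonempty
  have hbias := bias_le_half hn hτ hε hN hd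
  have hstep : ∀ ℓ ∈ Finset.Icc 1 k, η ℓ * ∫ ω, G.nikaidoIsoda θ (ρ ℓ fun t => X t ω) ∂μ ≤
      η ℓ * ∫ ω, StochasticGame.linearRegret θ
        (StochasticGame.iterateEstimate G d ρ ℓ fun t => X t ω) ∂μ + η ℓ * (ε / 2) := by
    intro ℓ hℓ
    have hℓ1 := (Finset.mem_Icc.1 hℓ).1
    have h1 := (hX.integral_nikaidoIsoda_sub_le hρ₁m hρ₁0 hρ hd_pos hτ hmix hℓ1 hθm).trans hbias
    rw [integral_sub (hΨ ℓ hℓ) (hD ℓ hℓ)] at h1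
    rw [← mul_add]
    exact mul_le_mul_of_nonneg_left (by linarith) (hη ℓ hℓ1)
  have hregret : ∑ ℓ ∈ Finset.Icc 1 k, η ℓ * ∫ ω, StochasticGame.linearRegret θ
      (StochasticGame.iterateEstimate G d ρ ℓ fun t => X t ω) ∂μ ≤
      ∑ i, klDivergence (θ i) (ρ₁ i) + 1 / 2 * ∑ ℓ ∈ Finset.Icc 1 k, η ℓ ^ 2 *
        ∫ ω, StochasticGame.localNormSq
          (StochasticGame.iterateEstimate G d ρ ℓ fun t => X t ω) ∂μ := by
    have h1 := integral_mono (μ := μ)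
      (integrable_finsetSum _ fun ℓ hℓ => (hD ℓ hℓ).const_mul (η ℓ))
      ((integrable_const (∑ i, klDivergence (θ i) (ρ₁ i))).add
        ((integrable_finsetSum _ fun ℓ hℓ => (hQ ℓ hℓ).const_mul (η ℓ ^ 2)).const_mul (1 / 2)))
      fun ω => hρ.sum_linearRegret_le hρ₁m hρ₁0 hη (fun t => X t ω) hθm k
    rw [integral_finsetSum _ fun ℓ hℓ => (hD ℓ hℓ).const_mul (η ℓ),
      integral_add' (integrable_const _)
        ((integrable_finsetSum _ fun ℓ hℓ => (hQ ℓ hℓ).const_mul (η ℓ ^ 2)).const_mul (1 / 2)),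
      integral_const_mul, integral_finsetSum _ fun ℓ hℓ => (hQ ℓ hℓ).const_mul (η ℓ ^ 2)] at h1
    simpa [integral_const_mul] using h1
  have hnorm : ∑ ℓ ∈ Finset.Icc 1 k, η ℓ ^ 2 * ∫ ω, StochasticGame.localNormSq
      (StochasticGame.iterateEstimate G d ρ ℓ fun t => X t ω) ∂μ ≤
      (∑ i, (Fintype.card (A i) : ℝ)) * ∑ ℓ ∈ Finset.Icc 1 k, η ℓ ^ 2 := by
    rw [Finset.mul_sum]
    refine Finset.sum_le_sum fun ℓ hℓ => ?_
    rw [mul_comm (∑ i, (Fintype.card (A i) : ℝ))]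
    exact mul_le_mul_of_nonneg_left (hX.integral_localNormSq_le hρ₁m hρ₁0 hρ hd_pos hτ hmix
      (Finset.mem_Icc.1 hℓ).1) (sq_nonneg _)
  have hkl : ∑ i, klDivergence (θ i) (ρ₁ i) ≤
      2 * ∑ i, Real.log ((Fintype.card (S i) : ℝ) * Fintype.card (A i)) := by
    rw [Finset.mul_sum]
    exact Finset.sum_le_sum fun i _ => hρ₁_kl i _ (hθ i)
  have htotal : ∑ ℓ ∈ Finset.Icc 1 k, η ℓ * ∫ ω, G.nikaidoIsoda θ (ρ ℓ fun t => X t ω) ∂μ ≤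
      ε * w := by
    have h1 := Finset.sum_le_sum hstep
    rw [Finset.sum_add_distrib, ← Finset.sum_mul, ← hw] at h1
    rw [one_div_mul_eq_div, div_le_iff₀ hε] at hk
    linarith
  have e : ∑ ℓ ∈ Finset.Icc 1 k, η ℓ / w * ∫ ω, G.nikaidoIsoda θ (ρ ℓ fun t => X t ω) ∂μ =
      (∑ ℓ ∈ Finset.Icc 1 k, η ℓ * ∫ ω, G.nikaidoIsoda θ (ρ ℓ fun t => X t ω) ∂μ) / w := by
    rw [Finset.sum_div]
    exact Finset.sum_congr rfl fun ℓ _ => by ring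
  rw [e]
  -- this includes the case `w = 0`, in which all the weights are zero
  exact div_le_of_le_mul₀ hw0 hε.le htotal
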